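/- Let $I=[0,1]$ with Lebesgue measure $m$, let $1<t\le p<\infty$ and $\varepsilon=1/p$. Let $\tau:I\to I$ be a piecewise expanding $C^{1+\varepsilon}$ map: there is a partition $0=a_0<a_1<\dots<a_q=1$ such that on each $I_i=(a_{i-1},a_i)$ the map $\tau$ is monotonic and extends to a $C^1$ function on $\overline{I_i}$, and there are constants $M_i$ and $s_i>1$ with $|\tau'(x)-\tau'(y)|\le M_i|x-y|^{\varepsilon}$ and $|\tau'(x)|\ge s_i$ for all $x,y\in I_i$. Put $s=\min_i s_i$, $M=\max_i M_i$, and let $P_\tau f(x)=\sum_{y\in\tau^{-1}(x)} f(y)/|\tau'(y)|$ (for almost every $x$) be the Frobenius-Perron operator. For $A>0$ and $f:I\to\mathbb C$ let $$\operatorname{osc}(f,r,x)=\sup_{y_1,y_2\in(x-r,x+r)\cap I}|f(y_1)-f(y_2)|,\qquad \operatorname{var}_{t,1/p}(f)=\sup_{0<r\le A}\frac{\|\operatorname{osc}(f,r,\cdot)\|_{L^t}}{r^{1/p}};$$ the variation of an $m$-equivalence class is the infimum of this quantity over its representatives, $BV_{t,1/p}$ is the space of classes of finite variation, and $\|f\|_{t,1/p}=\operatorname{var}_{t,1/p}(f)+\|f\|_t$.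 (a) For every $A>0$ there exist constants $\alpha>0$ and $K>0$ such that $$\|P_\tau f\|_{t,1/p}\le\alpha\,\|f\|_{t,1/p}+K\,\|f\|_t\qquad\text{for all } f\in BV_{t,1/p},$$ and $P_\tau(BV_{t,1/p})\subset BV_{t,1/p}$. (b) There is $A_0>0$ such that for every $0<A\le A_0$, with $D=M A^{1/p}/s^{1+1/p}$ and $$\alpha=\frac{2^{1/p}\,q\,D(1+D)}{s^{1+1/p-1/t}}+\frac{2q(1+D)}{s^{1+1/p-1/t}}+\frac{2q(1+D)}{s},\qquad \beta=\frac{2^{1/p}\,q\,M(1+D)}{s^{2+1/p-1/t}}+\frac{2q(1+D)}{s\,A^{1/p}},$$ one has $\alpha\ge 1$, $\beta>0$, $$\operatorname{var}_{t,1/p}(P_\tau f)\le\alpha\,\|f\|_{t,1/p}+\beta\,\|f\|_t\qquad\text{for all } f\in BV_{t,1/p},$$ and, for some constant $K>0$ and with this same $\alpha$, $$\|P_\tau f\|_{t,1/p}\le\alpha\,\|f\|_{t,1/p}+K\,\|f\|_t\qquad\text{for all } f\in BV_{t,1/p}.$$ -/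

import Mathlib

open MeasureTheory Set
open scoped ENNReal unitInterval

/-- Oscillation `osc(f, r, x) = sup_{y₁, y₂ ∈ S_r(x)} |f y₁ - f y₂|` of a function on `I = [0,1]`,
with values in `[0, ∞]`.  The ball of the metric space `I` is `S_r(x) = (x - r, x + r) ∩ I`. -/
noncomputable def bvOsc (f : I → ℂ) (r : ℝ) (x : I) : ℝ≥0∞ :=
  ⨆ y₁ ∈ Metric.ball x r, ⨆ y₂ ∈ Metric.ball x r, ‖f y₁ - f y₂‖ₑ

/-- `osc_q(f, r) = ‖osc(f, r, ·)‖_q`, the norm of `L^q(I)` for Lebesgue measure. -/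
noncomputable def bvOscNorm (q : ℝ≥0∞) (f : I → ℂ) (r : ℝ) : ℝ≥0∞ :=
  eLpNorm (bvOsc f r) q (volume : Measure I)

/-- The variation `sup_{0 < r ≤ A} osc_q(f, r) / r^{1/p}` of one given function. -/
noncomputable def bvVarFun (A : ℝ) (q : ℝ≥0∞) (p : ℝ) (f : I → ℂ) : ℝ≥0∞ :=
  ⨆ r ∈ Ioc (0 : ℝ) A, bvOscNorm q f r / ENNReal.ofReal r ^ (1 / p)

/-- The variation `var_{q,1/p}` of the almost-everywhere class of `f`: the least variation of a
representative. -/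
noncomputable def bvVar (A : ℝ) (q : ℝ≥0∞) (p : ℝ) (f : I → ℂ) : ℝ≥0∞ :=
  ⨅ (g : I → ℂ) (_ : g =ᵐ[(volume : Measure I)] f), bvVarFun A q p g

/-- `f` represents an element of `BV_{q,1/p}`, the space of almost-everywhere classes of
functions of bounded variation `var_{q,1/p}`. -/
def MemBV (A : ℝ) (q : ℝ≥0∞) (p : ℝ) (f : I → ℂ) : Prop :=
  AEStronglyMeasurable f (volume : Measure I) ∧ bvVar A q p f < ∞

/-- The norm `‖f‖_{q,1/p} = var_{q,1/p}(f) + ‖f‖_q`. -/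
noncomputable def bvNorm (A : ℝ) (q : ℝ≥0∞) (p : ℝ) (f : I → ℂ) : ℝ≥0∞ :=
  bvVar A q p f + eLpNorm f q (volume : Measure I)

/-- The map `τ : I → I` as a real function; it agrees with `τ` on `[0,1]` and is constant on
each side of it. -/
noncomputable def intervalMapExt (τ : I → I) : ℝ → ℝ :=
  IccExtend (zero_le_one' ℝ) (fun y : I => (τ y : ℝ))

/-- The derivative `τ'`; only its values inside the intervals of the partition matter. -/
noncomputable def intervalMapDeriv (τ : I → I) (x : ℝ) : ℝ := deriv (intervalMapExt τ) x

/-- The data which show that `τ : I → I` is a piecewise expanding `C^{1+ε}` map: a partition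
`0 = a_0 < a_1 < ⋯ < a_q = 1`, on whose open intervals `I_i` the map is monotonic and has a `C^1`
extension to the closure, with an `ε`-Hölder derivative (constants `M_i`) and `|τ'| ≥ s_i > 1`. -/
structure ExpandingPartition (ε : ℝ) (τ : I → I) where
  /-- the number of intervals -/
  q : ℕ
  /-- the end points -/
  a : Fin (q + 1) → ℝ
  strictMono_a : StrictMono a
  a_zero : a 0 = 0
  a_last : a (Fin.last q) = 1
  monotonic : ∀ i : Fin q,
    MonotoneOn (intervalMapExt τ) (Ioo (a i.castSucc) (a i.succ)) ∨
      AntitoneOn (intervalMapExt τ) (Ioo (a i.castSucc) (a i.succ))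
  exists_extension : ∀ i : Fin q, ∃ φ : ℝ → ℝ,
    ContDiffOn ℝ 1 φ (Icc (a i.castSucc) (a i.succ)) ∧
      EqOn (intervalMapExt τ) φ (Ioo (a i.castSucc) (a i.succ))
  /-- the Hölder constants `M_i` -/
  holderConst : Fin q → ℝ
  holder : ∀ i : Fin q, ∀ x ∈ Ioo (a i.castSucc) (a i.succ), ∀ y ∈ Ioo (a i.castSucc) (a i.succ),
    |intervalMapDeriv τ x - intervalMapDeriv τ y| ≤ holderConst i * |x - y| ^ ε
  /-- the lower bounds `s_i` of the slope -/
  slope : Fin q → ℝ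
  one_lt_slope : ∀ i, 1 < slope i
  slope_le : ∀ i : Fin q, ∀ x ∈ Ioo (a i.castSucc) (a i.succ), slope i ≤ |intervalMapDeriv τ x|

namespace ExpandingPartition

variable {ε : ℝ} {τ : I → I}

/-- `s = min_i s_i` (a minimum over a finite nonempty set, since `a_0 ≠ a_q` forces `q ≥ 1`). -/
noncomputable def s (P : ExpandingPartition ε τ) : ℝ := ⨅ i, P.slope i

/-- `M = max_i M_i`. -/
noncomputable def M (P : ExpandingPartition ε τ) : ℝ := ⨆ i, P.holderConst i

/-- `D = M A^{1/p} / s^{1+1/p}`. -/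
noncomputable def D (P : ExpandingPartition ε τ) (A p : ℝ) : ℝ :=
  P.M * A ^ (1 / p) / P.s ^ (1 + 1 / p)

/-- `α = 2^{1/p} q D (1+D) / s^{1+1/p-1/t} + 2 q (1+D) / s^{1+1/p-1/t} + 2 q (1+D) / s`. -/
noncomputable def alpha (P : ExpandingPartition ε τ) (A t p : ℝ) : ℝ :=
  2 ^ (1 / p) * P.q * P.D A p * (1 + P.D A p) / P.s ^ (1 + 1 / p - 1 / t)
    + 2 * P.q * (1 + P.D A p) / P.s ^ (1 + 1 / p - 1 / t)
    + 2 * P.q * (1 + P.D A p) / P.s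

/-- `β = 2^{1/p} q M (1+D) / s^{2+1/p-1/t} + 2 q (1+D) / (s B^{1/p})` with `B = A`. -/
noncomputable def beta (P : ExpandingPartition ε τ) (A t p : ℝ) : ℝ :=
  2 ^ (1 / p) * P.q * P.M * (1 + P.D A p) / P.s ^ (2 + 1 / p - 1 / t)
    + 2 * P.q * (1 + P.D A p) / (P.s * A ^ (1 / p))

end ExpandingPartition

/-- The Frobenius-Perron operator `P_τ f (x) = ∑_{y ∈ τ⁻¹(x)} f(y) / |τ'(y)|`.  The fibres of a
piecewise expanding map are finite. The images of the finitely many end points of the partition,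
where `τ'` may be meaningless, form a null set. -/
noncomputable def frobeniusPerron (τ : I → I) (f : I → ℂ) (x : I) : ℂ :=
  ∑ᶠ (y : I) (_ : τ y = x), f y * ((|intervalMapDeriv τ y|⁻¹ : ℝ) : ℂ)

/-! The operator is, up to a null set, a sum over the branches of `τ`; each contributes `g ∘ inv`
times the weight `|τ'|⁻¹ ∘ inv`, cut off outside the image interval `(c, d)`. The oscillation of one
such term at radius `r` is bounded pointwise in `ExpandingBranch.bvOsc_transfer_le`. For `x` in `(c,
d)` with both test points there, the product rule gives the oscillation of `g` at the contracted
radius `r / s`, times the weight at `x`, plus a distortion error of relative size `δ = M (r/s)^ε /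
s` coming from the Hölder condition. For `x` outside, reflection in the nearer end moves `x` into
`(c, d)` and reduces to the same estimate. If one test point leaves `(c, d)`, the jump at the
cut-off is at most `1/s` times a supremum of `|g|` near an end of the partition interval.

In `L^t`, a change of variables costs `s^(1/t - 1)` (`lintegralNorm_pull_le`), and the two reflected
strips together cost no more than the original function (`lintegralNorm_reflect_le`). The suprema
are controlled by `N = ‖ |g| + osc(g, A) ‖_t`, since a value of `|g|` is dominated by `|g| + osc(g,
A)` on a whole interval around the point. Interior partition points belong to two intervals and have
full neighbourhoods; `0` and `1` belong to one and have half neighbourhoods. The sum over all ends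
is therefore `2 q N` (`sum_supNear_le`). As `N ≤ ‖g‖_t + A^(1/p) var(g)`, dividing by `r^(1/p)`
yields the explicit constants (`coeff_le`); here `t ≤ p` and `r ≤ A` give `(r/A)^(1/t) ≤
(r/A)^(1/p)`.

All of this is done for a fixed representative `g`, and the infimum over representatives is taken at
the end. For arbitrary `A`, radii above a small scale are handled by the crude bound `osc ≤ 2 sup`.
The bound `α ≥ 1` follows from `s ≤ q`: the images have total length at least `s` and at most `q`.
-/

/-! ### Norms on the line and extension by zero. -/

/-- The `L^t` norm, with respect to Lebesgue measure on `ℝ`, of a function with values in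
`[0, ∞]`. -/
noncomputable def lintegralNorm (t : ℝ) (Φ : ℝ → ℝ≥0∞) : ℝ≥0∞ := (∫⁻ x, Φ x ^ t) ^ (1 / t)

/-- Extension of a function on `[0,1]` by zero. -/
noncomputable def zeroExt (u : I → ℝ≥0∞) : ℝ → ℝ≥0∞ :=
  (Icc (0 : ℝ) 1).indicator fun x => u (projIcc 0 1 zero_le_one x)

lemma zeroExt_coe (u : I → ℝ≥0∞) (x : I) : zeroExt u (x : ℝ) = u x := by
  simp [zeroExt]

lemma zeroExt_of_mem (u : I → ℝ≥0∞) {x : ℝ} (hx : x ∈ Icc (0 : ℝ) 1) :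
    zeroExt u x = u ⟨x, hx⟩ := zeroExt_coe u ⟨x, hx⟩

lemma measurable_zeroExt {u : I → ℝ≥0∞} (hu : Measurable u) : Measurable (zeroExt u) :=
  (hu.comp continuous_projIcc.measurable).indicator measurableSet_Icc

lemma lintegral_unitInterval (u : I → ℝ≥0∞) :
    ∫⁻ x, u x = ∫⁻ x in Icc (0 : ℝ) 1, u (projIcc 0 1 zero_le_one x) := by
  rw [← lintegral_subtype_comap measurableSet_Icc]
  simp [unitInterval.volume_def]

section lintegralNorm

variable {t : ℝ}

lemma lintegralNorm_mono_ae (ht : 1 ≤ t) {Φ Ψ : ℝ → ℝ≥0∞} (h : ∀ᵐ x, Φ x ≤ Ψ x) :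
    lintegralNorm t Φ ≤ lintegralNorm t Ψ := by
  refine ENNReal.rpow_le_rpow (lintegral_mono_ae ?_) (by positivity)
  filter_upwards [h] with x hx
  exact ENNReal.rpow_le_rpow hx (by linarith)

lemma lintegralNorm_mono (ht : 1 ≤ t) {Φ Ψ : ℝ → ℝ≥0∞} (h : ∀ x, Φ x ≤ Ψ x) :
    lintegralNorm t Φ ≤ lintegralNorm t Ψ :=
  lintegralNorm_mono_ae ht (Filter.Eventually.of_forall h)

lemma lintegralNorm_congr_ae (ht : 1 ≤ t) {Φ Ψ : ℝ → ℝ≥0∞} (h : ∀ᵐ x, Φ x = Ψ x) :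
    lintegralNorm t Φ = lintegralNorm t Ψ :=
  le_antisymm (lintegralNorm_mono_ae ht (h.mono fun _ hx => hx.le))
    (lintegralNorm_mono_ae ht (h.mono fun _ hx => hx.ge))

lemma lintegralNorm_add_le (ht : 1 ≤ t) {Φ Ψ : ℝ → ℝ≥0∞} (hΦ : Measurable Φ) (hΨ : Measurable Ψ) :
    lintegralNorm t (fun x => Φ x + Ψ x) ≤ lintegralNorm t Φ + lintegralNorm t Ψ :=
  ENNReal.lintegral_Lp_add_le hΦ.aemeasurable hΨ.aemeasurable ht

lemma lintegralNorm_const_mul (ht : 1 ≤ t) {c : ℝ≥0∞} (hc : c ≠ ∞) (Φ : ℝ → ℝ≥0∞) :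
    lintegralNorm t (fun x => c * Φ x) = c * lintegralNorm t Φ := by
  have h0 : 0 < t := by linarith
  unfold lintegralNorm
  simp_rw [ENNReal.mul_rpow_of_nonneg _ _ h0.le]
  rw [lintegral_const_mul' _ _ (ENNReal.rpow_ne_top_of_nonneg h0.le hc),
    ENNReal.mul_rpow_of_nonneg _ _ (by positivity), ← ENNReal.rpow_mul,
    mul_one_div_cancel h0.ne', ENNReal.rpow_one]

lemma lintegralNorm_zero (ht : 1 ≤ t) : lintegralNorm t (fun _ => 0) = 0 := by
  have h0 : 0 < t := by linarith
  simp [lintegralNorm, ENNReal.zero_rpow_of_pos h0, h0]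

lemma lintegralNorm_sum_le (ht : 1 ≤ t) {ι : Type*} (s : Finset ι) {Φ : ι → ℝ → ℝ≥0∞}
    (hΦ : ∀ i, Measurable (Φ i)) :
    lintegralNorm t (fun x => ∑ i ∈ s, Φ i x) ≤ ∑ i ∈ s, lintegralNorm t (Φ i) := by
  classical
  induction s using Finset.induction_on with
  | empty => simp [lintegralNorm_zero ht]
  | insert i s hi ih =>
    simp_rw [Finset.sum_insert hi]
    exact (lintegralNorm_add_le ht (hΦ i) (Finset.measurable_fun_sum _ fun j _ => hΦ j)).trans
      (by gcongr)

lemma indicator_rpow_of_pos (ht : 0 < t) (s : Set ℝ) (Φ : ℝ → ℝ≥0∞) (x : ℝ) :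
    (s.indicator Φ x) ^ t = s.indicator (fun x => Φ x ^ t) x := by
  by_cases hx : x ∈ s <;> simp [hx, ENNReal.zero_rpow_of_pos ht]

lemma lintegralNorm_indicator (ht : 1 ≤ t) {s : Set ℝ} (hs : MeasurableSet s) (Φ : ℝ → ℝ≥0∞) :
    lintegralNorm t (s.indicator Φ) = (∫⁻ x in s, Φ x ^ t) ^ (1 / t) := by
  unfold lintegralNorm
  simp_rw [indicator_rpow_of_pos (zero_lt_one.trans_le ht)]
  rw [lintegral_indicator hs]

lemma lintegralNorm_indicator_const (ht : 1 ≤ t) (e r : ℝ) (c : ℝ≥0∞) :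
    lintegralNorm t ((Metric.ball e r).indicator fun _ => c)
      = c * ENNReal.ofReal (2 * r) ^ (1 / t) := by
  have h0 : 0 < t := by linarith
  rw [lintegralNorm_indicator ht Metric.isOpen_ball.measurableSet, setLIntegral_const,
    Real.volume_ball, ENNReal.mul_rpow_of_nonneg _ _ (by positivity), ← ENNReal.rpow_mul,
    mul_one_div_cancel h0.ne', ENNReal.rpow_one]

lemma eLpNorm_unitInterval (ht : 1 ≤ t) {ε : Type*} [ENorm ε] (f : I → ε) :
    eLpNorm f (ENNReal.ofReal t) volume = lintegralNorm t (zeroExt fun x => ‖f x‖ₑ) := by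
  have h0 : 0 < t := by linarith
  rw [eLpNorm_eq_lintegral_rpow_enorm_toReal (by simpa using h0) ENNReal.ofReal_ne_top,
    ENNReal.toReal_ofReal h0.le, lintegral_unitInterval, zeroExt,
    lintegralNorm_indicator ht measurableSet_Icc]

end lintegralNorm

/-! ### Oscillation and variation of a fixed function. -/

/-- The balls are open, so a pair of points admissible for `x` stays admissible for nearby centres.
This makes the oscillation measurable even if `f` is not. -/
lemma lowerSemicontinuous_bvOsc (f : I → ℂ) (r : ℝ) : LowerSemicontinuous (bvOsc f r) := by
  intro x c hc
  simp only [bvOsc, lt_iSup_iff] at hc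
  obtain ⟨y₁, h₁, y₂, h₂, h⟩ := hc
  have e₁ : ∀ᶠ x' in nhds x, dist y₁ x' < r :=
    (continuous_const.dist continuous_id).continuousAt.eventually_lt_const h₁
  have e₂ : ∀ᶠ x' in nhds x, dist y₂ x' < r :=
    (continuous_const.dist continuous_id).continuousAt.eventually_lt_const h₂
  filter_upwards [e₁, e₂] with x' k₁ k₂
  simp only [bvOsc, lt_iSup_iff]
  exact ⟨y₁, k₁, y₂, k₂, h⟩

lemma measurable_bvOsc (f : I → ℂ) (r : ℝ) : Measurable (bvOsc f r) :=
  (lowerSemicontinuous_bvOsc f r).measurable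

lemma enorm_sub_le_bvOsc (f : I → ℂ) {r : ℝ} {x y₁ y₂ : I} (h₁ : dist y₁ x < r)
    (h₂ : dist y₂ x < r) : ‖f y₁ - f y₂‖ₑ ≤ bvOsc f r x :=
  le_iSup₂_of_le y₁ h₁ (le_iSup₂_of_le y₂ h₂ le_rfl)

lemma enorm_le_enorm_add_bvOsc (f : I → ℂ) {r : ℝ} (hr : 0 < r) {x y : I} (h : dist y x < r) :
    ‖f y‖ₑ ≤ ‖f x‖ₑ + bvOsc f r x := by
  calc ‖f y‖ₑ = ‖f x + (f y - f x)‖ₑ := by rw [add_sub_cancel]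
    _ ≤ ‖f x‖ₑ + ‖f y - f x‖ₑ := enorm_add_le _ _
    _ ≤ _ := by
      gcongr
      exact enorm_sub_le_bvOsc f h (by simpa using hr)

lemma bvOsc_sum_le {ι : Type*} (s : Finset ι) (F : ι → I → ℂ) (r : ℝ) (x : I) :
    bvOsc (fun x => ∑ i ∈ s, F i x) r x ≤ ∑ i ∈ s, bvOsc (F i) r x := by
  refine iSup₂_le fun y₁ h₁ => iSup₂_le fun y₂ h₂ => ?_
  rw [← Finset.sum_sub_distrib]
  exact (enorm_sum_le _ _).trans (Finset.sum_le_sum fun i _ => enorm_sub_le_bvOsc _ h₁ h₂)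

lemma bvOsc_le_two_mul (f : I → ℂ) {K : ℝ≥0∞} (hK : ∀ x, ‖f x‖ₑ ≤ K) (r : ℝ) (x : I) :
    bvOsc f r x ≤ 2 * K := by
  refine iSup₂_le fun y₁ h₁ => iSup₂_le fun y₂ h₂ => ?_
  rw [two_mul]
  exact (enorm_sub_le).trans (add_le_add (hK _) (hK _))

lemma bvOscNorm_eq {t : ℝ} (ht : 1 ≤ t) (f : I → ℂ) (r : ℝ) :
    bvOscNorm (ENNReal.ofReal t) f r = lintegralNorm t (zeroExt (bvOsc f r)) := by
  rw [bvOscNorm, eLpNorm_unitInterval ht]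
  rfl

lemma bvOscNorm_le {t A p r : ℝ} (f : I → ℂ) (hr : 0 < r) (hrA : r ≤ A) :
    bvOscNorm (ENNReal.ofReal t) f r
      ≤ ENNReal.ofReal (r ^ (1 / p)) * bvVarFun A (ENNReal.ofReal t) p f := by
  have h : bvOscNorm (ENNReal.ofReal t) f r / ENNReal.ofReal r ^ (1 / p)
      ≤ bvVarFun A (ENNReal.ofReal t) p f :=
    le_iSup₂_of_le (f := fun r (_ : r ∈ Ioc 0 A) =>
      bvOscNorm (ENNReal.ofReal t) f r / ENNReal.ofReal r ^ (1 / p)) r ⟨hr, hrA⟩ le_rfl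
  rw [ENNReal.ofReal_rpow_of_pos hr] at h
  have hp : 0 < r ^ (1 / p) := Real.rpow_pos_of_pos hr _
  rwa [ENNReal.div_le_iff' (by simpa using hp) ENNReal.ofReal_ne_top] at h

lemma bvVarFun_le {t A p : ℝ} {f : I → ℂ} {K : ℝ≥0∞}
    (h : ∀ r, 0 < r → r ≤ A →
      bvOscNorm (ENNReal.ofReal t) f r ≤ ENNReal.ofReal (r ^ (1 / p)) * K) :
    bvVarFun A (ENNReal.ofReal t) p f ≤ K := by
  refine iSup₂_le fun r hr => ?_
  rw [ENNReal.ofReal_rpow_of_pos hr.1]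
  have hp : 0 < r ^ (1 / p) := Real.rpow_pos_of_pos hr.1 _
  rw [ENNReal.div_le_iff' (by simpa using hp) ENNReal.ofReal_ne_top]
  exact h r hr.1 hr.2

lemma bvVarFun_mono {A B : ℝ} (h : A ≤ B) (q : ℝ≥0∞) (p : ℝ) (f : I → ℂ) :
    bvVarFun A q p f ≤ bvVarFun B q p f :=
  biSup_mono fun _ hr => ⟨hr.1, hr.2.trans h⟩

/-! ### Local suprema bounded by `L^t` norms. -/

/-- The sum of the absolute value and of the oscillation of a function. -/
noncomputable def absAddOsc (g : I → ℂ) (A : ℝ) (x : I) : ℝ≥0∞ := ‖g x‖ₑ + bvOsc g A x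

section sup

variable {t A : ℝ}

/-- Every point of `(u, v)` is within `A` of `z`, so `|g| + osc(g, A)` is at least `|g z|` there;
integrate over the interval. The bound holds at every point `z`, not just almost everywhere. -/
lemma enorm_mul_le_lintegralNorm (ht : 1 ≤ t) (hA : 0 < A) (g : I → ℂ) (z : I) {u v : ℝ}
    (hu : 0 ≤ u) (hv : v ≤ 1) (hu' : z - A ≤ u) (hv' : v ≤ z + A) :
    ‖g z‖ₑ * ENNReal.ofReal (v - u) ^ (1 / t)
      ≤ lintegralNorm t ((Ioo u v).indicator (zeroExt (absAddOsc g A))) := by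
  have h0 : 0 < t := by linarith
  rw [lintegralNorm_indicator ht measurableSet_Ioo]
  have key : ∫⁻ _ in Ioo u v, ‖g z‖ₑ ^ t ≤ ∫⁻ x in Ioo u v, zeroExt (absAddOsc g A) x ^ t := by
    refine setLIntegral_mono' measurableSet_Ioo fun x hx => ENNReal.rpow_le_rpow ?_ h0.le
    rw [zeroExt_of_mem _ ⟨hu.trans hx.1.le, hx.2.le.trans hv⟩]
    refine enorm_le_enorm_add_bvOsc g hA ?_
    rw [Subtype.dist_eq, Real.dist_eq, abs_lt]
    constructor <;> linarith [hx.1, hx.2]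
  refine le_trans (le_of_eq ?_) (ENNReal.rpow_le_rpow key (by positivity))
  rw [setLIntegral_const, Real.volume_Ioo, ENNReal.mul_rpow_of_nonneg _ _ (by positivity),
    ← ENNReal.rpow_mul, mul_one_div_cancel h0.ne', ENNReal.rpow_one]

/-- The supremum of `|g|` on the points of `[0,1]` with distance less than `ρ` from `e`. -/
noncomputable def supNear (g : I → ℂ) (ρ e : ℝ) : ℝ≥0∞ :=
  ⨆ (z : I) (_ : |(z : ℝ) - e| < ρ), ‖g z‖ₑ

lemma enorm_le_supNear (g : I → ℂ) {ρ e : ℝ} {z : I} (h : |(z : ℝ) - e| < ρ) :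
    ‖g z‖ₑ ≤ supNear g ρ e :=
  le_iSup₂_of_le (f := fun (z : I) (_ : |(z : ℝ) - e| < ρ) => ‖g z‖ₑ) z h le_rfl

lemma supNear_mul_le {ρ e : ℝ} {g : I → ℂ} {c N : ℝ≥0∞}
    (h : ∀ z : I, |(z : ℝ) - e| < ρ → ‖g z‖ₑ * c ≤ N) : supNear g ρ e * c ≤ N := by
  simp only [supNear, ENNReal.iSup_mul]
  exact iSup₂_le h

lemma lintegralNorm_indicator_le (ht : 1 ≤ t) (s : Set ℝ) (Φ : ℝ → ℝ≥0∞) :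
    lintegralNorm t (s.indicator Φ) ≤ lintegralNorm t Φ :=
  lintegralNorm_mono ht fun _ => indicator_le_self' (fun _ _ => zero_le) _

/-- A point within `2A` of `e` still has its full neighbourhood of radius `A` inside `[0,1]`. -/
lemma supNear_interior_mul_le (ht : 1 ≤ t) (hA : 0 < A) (g : I → ℂ) {e : ℝ} (h0 : 3 * A ≤ e)
    (h1 : e ≤ 1 - 3 * A) :
    supNear g (2 * A) e * ENNReal.ofReal (2 * A) ^ (1 / t)
      ≤ lintegralNorm t (zeroExt (absAddOsc g A)) := by
  refine supNear_mul_le fun z hz => ?_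
  rw [abs_lt] at hz
  have := enorm_mul_le_lintegralNorm ht hA g z (u := z - A) (v := z + A) (by linarith)
    (by linarith) le_rfl le_rfl
  rw [show (z : ℝ) + A - (z - A) = 2 * A by ring] at this
  exact this.trans (lintegralNorm_indicator_le ht _ _)

/-- The `t`-th powers of the two norms add up to at most that of the whole; convexity of `x ^ t`
then compares the sum with the `t`-th powers. -/
lemma lintegralNorm_add_disjoint_le (ht : 1 ≤ t) {s₁ s₂ : Set ℝ} (h₁ : MeasurableSet s₁)
    (h₂ : MeasurableSet s₂) (hd : Disjoint s₁ s₂) (Φ : ℝ → ℝ≥0∞) :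
    lintegralNorm t (s₁.indicator Φ) + lintegralNorm t (s₂.indicator Φ)
      ≤ 2 ^ (1 - 1 / t) * lintegralNorm t Φ := by
  have h0 : 0 < t := by linarith
  set a := lintegralNorm t (s₁.indicator Φ) with ha
  set b := lintegralNorm t (s₂.indicator Φ) with hb
  have key : a ^ t + b ^ t ≤ lintegralNorm t Φ ^ t := by
    rw [ha, hb, lintegralNorm_indicator ht h₁, lintegralNorm_indicator ht h₂, lintegralNorm]
    simp_rw [← ENNReal.rpow_mul, one_div_mul_cancel h0.ne', ENNReal.rpow_one]
    rw [← lintegral_union h₂ hd]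
    exact setLIntegral_le_lintegral _ _
  have h := ENNReal.rpow_le_rpow ((ENNReal.rpow_add_le_mul_rpow_add_rpow a b ht).trans
    (by gcongr) : (a + b) ^ t ≤ 2 ^ (t - 1) * lintegralNorm t Φ ^ t)
    (show 0 ≤ 1 / t by positivity)
  rwa [ENNReal.mul_rpow_of_nonneg _ _ (by positivity), ← ENNReal.rpow_mul, ← ENNReal.rpow_mul,
    ← ENNReal.rpow_mul, mul_one_div_cancel h0.ne', ENNReal.rpow_one, ENNReal.rpow_one,
    show (t - 1) * (1 / t) = 1 - 1 / t by field_simp] at h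

/-- Near `0` and `1` only one-sided intervals of length `A` are available, which loses `2^(1/t)`.
They lie in different halves of `[0,1]`, so adding the two ends costs only `2^(1 - 1/t)`, and the
product of the two factors is exactly `2`. -/
lemma supNear_ends_mul_le (ht : 1 ≤ t) (hA : 0 < A) (hA' : 6 * A ≤ 1) (g : I → ℂ) :
    (supNear g (2 * A) 0 + supNear g (2 * A) 1) * ENNReal.ofReal (2 * A) ^ (1 / t)
      ≤ 2 * lintegralNorm t (zeroExt (absAddOsc g A)) := by
  have h0 : supNear g (2 * A) 0 * ENNReal.ofReal A ^ (1 / t)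
      ≤ lintegralNorm t ((Ioo 0 (1 / 2)).indicator (zeroExt (absAddOsc g A))) := by
    refine supNear_mul_le fun z hz => ?_
    rw [abs_lt] at hz
    have := enorm_mul_le_lintegralNorm ht hA g z (u := z) (v := z + A) z.2.1
      (by linarith) (by linarith) le_rfl
    rw [show (z : ℝ) + A - z = A by ring] at this
    refine this.trans (lintegralNorm_mono ht fun x =>
      indicator_le_indicator_of_subset (Ioo_subset_Ioo z.2.1 (by linarith)) (fun _ => zero_le) _)
  have h1 : supNear g (2 * A) 1 * ENNReal.ofReal A ^ (1 / t)
      ≤ lintegralNorm t ((Ioo (1 / 2) 1).indicator (zeroExt (absAddOsc g A))) := by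
    refine supNear_mul_le fun z hz => ?_
    rw [abs_lt] at hz
    have := enorm_mul_le_lintegralNorm ht hA g z (u := z - A) (v := z) (by linarith)
      z.2.2 le_rfl (by linarith)
    rw [show (z : ℝ) - (z - A) = A by ring] at this
    refine this.trans (lintegralNorm_mono ht fun x =>
      indicator_le_indicator_of_subset (Ioo_subset_Ioo (by linarith) z.2.2) (fun _ => zero_le) _)
  have hd : Disjoint (Ioo (0 : ℝ) (1 / 2)) (Ioo (1 / 2) 1) :=
    Set.disjoint_left.2 fun x hx hx' => (hx.2.trans hx'.1).false
  have h2 := (add_le_add h0 h1).trans (lintegralNorm_add_disjoint_le ht measurableSet_Ioo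
    measurableSet_Ioo hd (zeroExt (absAddOsc g A)))
  rw [ENNReal.ofReal_mul zero_le_two, ENNReal.mul_rpow_of_nonneg _ _ (by positivity)]
  calc _ = ENNReal.ofReal 2 ^ (1 / t) * (supNear g (2 * A) 0 * ENNReal.ofReal A ^ (1 / t)
        + supNear g (2 * A) 1 * ENNReal.ofReal A ^ (1 / t)) := by ring
    _ ≤ ENNReal.ofReal 2 ^ (1 / t) * (2 ^ (1 - 1 / t)
        * lintegralNorm t (zeroExt (absAddOsc g A))) := by gcongr
    _ = _ := by
      rw [← mul_assoc]
      congr 1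
      rw [ENNReal.ofReal_ofNat, ← ENNReal.rpow_add _ _ two_ne_zero ENNReal.ofNat_ne_top,
        add_sub_cancel, ENNReal.rpow_one]

lemma enorm_mul_le (ht : 1 ≤ t) (hA : 0 < A) (hA' : 6 * A ≤ 1) (g : I → ℂ) (z : I) :
    ‖g z‖ₑ * ENNReal.ofReal A ^ (1 / t) ≤ lintegralNorm t (zeroExt (absAddOsc g A)) := by
  rcases le_total (z : ℝ) (1 / 2) with hz | hz
  · have := enorm_mul_le_lintegralNorm ht hA g z (u := z) (v := z + A) z.2.1
      (by linarith) (by linarith) le_rfl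
    rw [show (z : ℝ) + A - z = A by ring] at this
    exact this.trans (lintegralNorm_indicator_le ht _ _)
  · have := enorm_mul_le_lintegralNorm ht hA g z (u := z - A) (v := z) (by linarith)
      z.2.2 le_rfl (by linarith)
    rw [show (z : ℝ) - (z - A) = A by ring] at this
    exact this.trans (lintegralNorm_indicator_le ht _ _)

lemma lintegralNorm_absAddOsc_le {p : ℝ} (ht : 1 ≤ t) (hA : 0 < A) {g : I → ℂ}
    (hg : AEStronglyMeasurable g volume) :
    lintegralNorm t (zeroExt (absAddOsc g A)) ≤ eLpNorm g (ENNReal.ofReal t) volume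
      + ENNReal.ofReal (A ^ (1 / p)) * bvVarFun A (ENNReal.ofReal t) p g := by
  have h0 : 0 < t := by linarith
  refine le_trans ?_ (add_le_add_right (bvOscNorm_le g hA le_rfl) _)
  have h := eLpNorm_add_le (μ := (volume : Measure I)) (p := ENNReal.ofReal t)
    (f := fun x => ‖g x‖ₑ) (g := bvOsc g A) hg.enorm.aestronglyMeasurable
    (measurable_bvOsc g A).aestronglyMeasurable (by simpa using ht)
  rw [eLpNorm_unitInterval ht, eLpNorm_unitInterval ht, eLpNorm_unitInterval ht] at h
  rw [bvOscNorm, eLpNorm_unitInterval ht, eLpNorm_unitInterval ht]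
  simp only [enorm_eq_self, Pi.add_apply] at h ⊢
  exact h

end sup

/-! ### Finite variation implies a finite `L^t` norm. -/

instance : (volume : Measure I).IsOpenPosMeasure where
  open_pos U hU hne := by
    obtain ⟨x, y, hxy, hsub⟩ := hU.exists_Ioo_subset hne
    refine ((?_ : 0 < volume (Ioo x y)).trans_le (measure_mono hsub)).ne'
    rw [unitInterval.volume_Ioo]
    simpa using hxy

/-- A function of finite variation has a finite `L^t` norm, since it is bounded up to a null
set. -/
lemma eLpNorm_lt_top_of_bvVar {A t p : ℝ} (hA : 0 < A) (ht : 1 ≤ t) {f : I → ℂ}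
    (hf : bvVar A (ENNReal.ofReal t) p f < ∞) : eLpNorm f (ENNReal.ofReal t) volume < ∞ := by
  have h0 : 0 < t := by linarith
  simp only [bvVar, iInf_lt_iff] at hf
  obtain ⟨g, hgf, hg⟩ := hf
  rw [← eLpNorm_congr_ae hgf]
  have hosc : bvOscNorm (ENNReal.ofReal t) g A < ∞ :=
    (bvOscNorm_le g hA le_rfl).trans_lt (ENNReal.mul_lt_top ENNReal.ofReal_lt_top hg)
  have hae : ∀ᵐ x, bvOsc g A x < ∞ := by
    have h1 : ∫⁻ x, bvOsc g A x ^ t ≠ ∞ := by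
      intro h
      rw [bvOscNorm, eLpNorm_eq_lintegral_rpow_enorm_toReal (by simpa using h0)
        ENNReal.ofReal_ne_top, ENNReal.toReal_ofReal h0.le] at hosc
      simp only [enorm_eq_self] at hosc
      rw [h, ENNReal.top_rpow_of_pos (by positivity)] at hosc
      exact hosc.false
    filter_upwards [ae_lt_top ((measurable_bvOsc g A).pow_const t) h1] with x hx
    by_contra hc
    rw [not_lt_top_iff.1 hc, ENNReal.top_rpow_of_pos h0] at hx
    exact hx.false
  -- By compactness finitely many balls of radius `A / 2` cover `I`. Density supplies, within `A /
  -- 2` of each centre, a point of finite oscillation, which bounds `g` on that ball.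
  have hdense := Measure.dense_of_ae hae
  obtain ⟨F, hcov⟩ := CompactSpace.elim_nhds_subcover (fun z : I => Metric.ball z (A / 2))
    fun z => Metric.ball_mem_nhds z (by positivity)
  choose c hc using fun z : I => hdense.exists_dist_lt z (ε := A / 2) (by positivity)
  have hb : ∀ z, ‖g z‖ₑ ≤ ∑ w ∈ F, (‖g (c w)‖ₑ + bvOsc g A (c w)) := by
    intro z
    have hz : z ∈ ⋃ w ∈ F, Metric.ball w (A / 2) := hcov ▸ mem_univ z
    simp only [mem_iUnion] at hz
    obtain ⟨w, hw, hzw⟩ := hz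
    refine le_trans ?_ (Finset.single_le_sum (f := fun w : I =>
      ‖g (c w)‖ₑ + bvOsc g A (c w)) (fun _ _ => zero_le) hw)
    refine enorm_le_enorm_add_bvOsc g hA ?_
    calc dist z (c w) ≤ dist z w + dist w (c w) := dist_triangle _ _ _
      _ < A / 2 + A / 2 := add_lt_add hzw (hc w).2
      _ = A := by ring
  have hK : ∑ w ∈ F, (‖g (c w)‖ₑ + bvOsc g A (c w)) < ∞ :=
    ENNReal.sum_lt_top.2 fun w _ => ENNReal.add_lt_top.2 ⟨enorm_lt_top, (hc w).1⟩
  rw [eLpNorm_eq_lintegral_rpow_enorm_toReal (by simpa using h0)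
        ENNReal.ofReal_ne_top, ENNReal.toReal_ofReal h0.le]
  refine ENNReal.rpow_lt_top_of_nonneg (by positivity) (ne_of_lt ?_)
  calc ∫⁻ x, ‖g x‖ₑ ^ t ≤ ∫⁻ _ : I, (∑ w ∈ F, (‖g (c w)‖ₑ + bvOsc g A (c w))) ^ t :=
        lintegral_mono fun x => ENNReal.rpow_le_rpow (hb x) h0.le
    _ = (∑ w ∈ F, (‖g (c w)‖ₑ + bvOsc g A (c w))) ^ t := by simp
    _ < ∞ := ENNReal.rpow_lt_top_of_nonneg h0.le hK.ne

/-! ### A single branch and the pointwise oscillation estimate. -/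

/-- An expanding branch of a real function `T`: an interval `(a,b) ⊆ [0,1]` which `T` maps
bijectively to an interval `(c,d)`, with slope at least `s` and a derivative that is Hölder
continuous with exponent `ε`, and the inverse `inv`, extended continuously. -/
structure ExpandingBranch (T : ℝ → ℝ) (ε s M : ℝ) where
  /-- left end of the domain -/
  a : ℝ
  /-- right end of the domain -/
  b : ℝ
  /-- left end of the image -/
  c : ℝ
  /-- right end of the image -/
  d : ℝ
  /-- the inverse -/
  inv : ℝ → ℝ
  a_nonneg : 0 ≤ a
  a_lt_b : a < b
  b_le_one : b ≤ 1
  c_lt_d : c < d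
  one_lt_s : 1 < s
  M_nonneg : 0 ≤ M
  ε_pos : 0 < ε
  differentiableAt : ∀ z ∈ Ioo a b, DifferentiableAt ℝ T z
  mapsTo : MapsTo T (Ioo a b) (Ioo c d)
  mapsTo_inv : MapsTo inv (Ioo c d) (Ioo a b)
  left_inv : ∀ z ∈ Ioo a b, inv (T z) = z
  right_inv : ∀ x ∈ Ioo c d, T (inv x) = x
  continuous_inv : Continuous inv
  dist_inv : ∀ x ∈ Icc c d, ∀ y ∈ Icc c d, s * |inv x - inv y| ≤ |x - y|
  inv_ends : inv c = a ∧ inv d = b ∨ inv c = b ∧ inv d = a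
  slope_le : ∀ z ∈ Ioo a b, s ≤ |deriv T z|
  holder : ∀ x ∈ Ioo a b, ∀ y ∈ Ioo a b, |deriv T x - deriv T y| ≤ M * |x - y| ^ ε

namespace ExpandingBranch

variable {T : ℝ → ℝ} {ε s M : ℝ}

lemma s_pos (B : ExpandingBranch T ε s M) : 0 < s := zero_lt_one.trans B.one_lt_s

variable (B : ExpandingBranch T ε s M)

lemma expansion : s * (B.b - B.a) ≤ B.d - B.c := by
  have h := B.dist_inv B.d ⟨B.c_lt_d.le, le_rfl⟩ B.c ⟨le_rfl, B.c_lt_d.le⟩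
  rw [abs_of_pos (sub_pos.2 B.c_lt_d)] at h
  have h' := sub_pos.2 B.a_lt_b
  rcases B.inv_ends with ⟨h1, h2⟩ | ⟨h1, h2⟩
  · rwa [h1, h2, abs_of_pos h'] at h
  · rwa [h1, h2, abs_sub_comm, abs_of_pos h'] at h

lemma mem_unitInterval {z : ℝ} (hz : z ∈ Ioo B.a B.b) : z ∈ Icc (0 : ℝ) 1 :=
  ⟨B.a_nonneg.trans hz.1.le, hz.2.le.trans B.b_le_one⟩

lemma image_eq : T '' Ioo B.a B.b = Ioo B.c B.d :=
  Subset.antisymm B.mapsTo.image_subset fun x hx => ⟨B.inv x, B.mapsTo_inv hx, B.right_inv x hx⟩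

lemma weight_le {z : ℝ} (hz : z ∈ Ioo B.a B.b) : |deriv T z|⁻¹ ≤ 1 / s := by
  rw [one_div]
  exact inv_anti₀ B.s_pos (B.slope_le z hz)

/-- From `1/a - 1/b = (b - a)/(ab)` and the Hölder condition. Both weights are kept as factors: one
can later be bounded by `1/s` and the other compared with the weight at a third point. -/
lemma abs_weight_sub_le {z₁ z₂ ρ : ℝ} (h₁ : z₁ ∈ Ioo B.a B.b) (h₂ : z₂ ∈ Ioo B.a B.b)
    (h : |z₁ - z₂| ≤ ρ) :
    |(|deriv T z₁|⁻¹ - |deriv T z₂|⁻¹)| ≤ M * ρ ^ ε * |deriv T z₁|⁻¹ * |deriv T z₂|⁻¹ := by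
  have p₁ := B.s_pos.trans_le (B.slope_le z₁ h₁)
  have p₂ := B.s_pos.trans_le (B.slope_le z₂ h₂)
  have hM := B.M_nonneg
  have key : |(|deriv T z₂| - |deriv T z₁|)| ≤ M * ρ ^ ε := by
    rw [abs_sub_comm]
    refine (abs_abs_sub_abs_le _ _).trans ((B.holder z₁ h₁ z₂ h₂).trans ?_)
    gcongr
    exact B.ε_pos.le
  rw [inv_sub_inv p₁.ne' p₂.ne', abs_div, abs_of_pos (mul_pos p₁ p₂), div_eq_mul_inv, mul_inv,
    mul_assoc (M * ρ ^ ε)]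
  gcongr

lemma weight_le_mul {z₁ z₂ ρ : ℝ} (h₁ : z₁ ∈ Ioo B.a B.b) (h₂ : z₂ ∈ Ioo B.a B.b)
    (h : |z₁ - z₂| ≤ ρ) :
    |deriv T z₁|⁻¹ ≤ (1 + M * ρ ^ ε / s) * |deriv T z₂|⁻¹ := by
  have k := (le_abs_self _).trans (B.abs_weight_sub_le h₁ h₂ h)
  have hM := B.M_nonneg
  have hρ : 0 ≤ ρ := (abs_nonneg _).trans h
  have k2 : M * ρ ^ ε * |deriv T z₁|⁻¹ * |deriv T z₂|⁻¹
      ≤ M * ρ ^ ε * (1 / s) * |deriv T z₂|⁻¹ := by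
    have := B.weight_le h₁
    gcongr
  have e : (1 + M * ρ ^ ε / s) * |deriv T z₂|⁻¹
      = |deriv T z₂|⁻¹ + M * ρ ^ ε * (1 / s) * |deriv T z₂|⁻¹ := by ring
  linarith

/-- The contribution of a branch to the Frobenius-Perron operator. -/
noncomputable def transfer (g : I → ℂ) (x : I) : ℂ :=
  (Ioo B.c B.d).indicator
    (fun x : ℝ => g (projIcc 0 1 zero_le_one (B.inv x)) * ((|deriv T (B.inv x)|⁻¹ : ℝ) : ℂ)) x

/-- The contribution of a branch to the Frobenius-Perron operator, for functions on `ℝ` with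
values in `[0, ∞]`. -/
noncomputable def pull (Φ : ℝ → ℝ≥0∞) : ℝ → ℝ≥0∞ :=
  (Ioo B.c B.d).indicator fun x => ENNReal.ofReal |deriv T (B.inv x)|⁻¹ * Φ (B.inv x)

lemma transfer_of_mem (g : I → ℂ) {x : I} (hx : (x : ℝ) ∈ Ioo B.c B.d) :
    B.transfer g x = g ⟨B.inv x, B.mem_unitInterval (B.mapsTo_inv hx)⟩
      * ((|deriv T (B.inv x)|⁻¹ : ℝ) : ℂ) := by
  rw [transfer, indicator_of_mem hx, projIcc_of_mem _ (B.mem_unitInterval (B.mapsTo_inv hx))]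

lemma transfer_of_notMem (g : I → ℂ) {x : I} (hx : (x : ℝ) ∉ Ioo B.c B.d) :
    B.transfer g x = 0 := indicator_of_notMem hx _

lemma measurable_pull {Φ : ℝ → ℝ≥0∞} (hΦ : Measurable Φ) : Measurable (B.pull Φ) := by
  refine Measurable.indicator ?_ measurableSet_Ioo
  have hinv := B.continuous_inv.measurable
  refine Measurable.mul ?_ (hΦ.comp hinv)
  exact ((measurable_norm.comp ((measurable_deriv T).comp hinv)).inv).ennreal_ofReal

lemma enorm_transfer_eq (g : I → ℂ) (x : I) :
    ‖B.transfer g x‖ₑ = B.pull (zeroExt fun z => ‖g z‖ₑ) x := by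
  by_cases hx : (x : ℝ) ∈ Ioo B.c B.d
  · rw [B.transfer_of_mem g hx, pull, indicator_of_mem hx, enorm_mul,
      zeroExt_of_mem _ (B.mem_unitInterval (B.mapsTo_inv hx)), mul_comm]
    congr 1
    rw [← ofReal_norm, Complex.norm_real, Real.norm_of_nonneg (by positivity)]
  · rw [B.transfer_of_notMem g hx, pull, indicator_of_notMem hx, enorm_zero]

/-- After the substitution `x = T z` the integrand is `|T'|^(1 - t) Φ^t`, and `1 - t ≤ 0` lets the
slope be replaced by its lower bound `s`. -/
lemma lintegralNorm_pull_le {t : ℝ} (ht : 1 ≤ t) (Φ : ℝ → ℝ≥0∞) :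
    lintegralNorm t (B.pull Φ)
      ≤ ENNReal.ofReal (s ^ (1 / t - 1)) * lintegralNorm t ((Ioo B.a B.b).indicator Φ) := by
  have h0 : 0 < t := by linarith
  have hs := B.s_pos
  have hinj : InjOn T (Ioo B.a B.b) := fun x hx y hy h => by
    rw [← B.left_inv x hx, h, B.left_inv y hy]
  rw [pull, lintegralNorm_indicator ht measurableSet_Ioo, lintegralNorm_indicator ht
    measurableSet_Ioo, ← B.image_eq, lintegral_image_eq_lintegral_abs_deriv_mul measurableSet_Ioo
    (fun x hx => (B.differentiableAt x hx).hasDerivAt.hasDerivWithinAt) hinj]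
  have key : ∫⁻ x in Ioo B.a B.b, ENNReal.ofReal |deriv T x|
        * (ENNReal.ofReal |deriv T (B.inv (T x))|⁻¹ * Φ (B.inv (T x))) ^ t
      ≤ ∫⁻ x in Ioo B.a B.b, ENNReal.ofReal (s ^ (1 - t)) * Φ x ^ t := by
    refine setLIntegral_mono' measurableSet_Ioo fun x hx => ?_
    have hp := hs.trans_le (B.slope_le x hx)
    rw [B.left_inv x hx, ENNReal.mul_rpow_of_nonneg _ _ h0.le, ← mul_assoc,
      ENNReal.ofReal_rpow_of_pos (inv_pos.2 hp), ← ENNReal.ofReal_mul hp.le]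
    gcongr
    calc |deriv T x| * |deriv T x|⁻¹ ^ t = |deriv T x| ^ (1 - t) := by
          rw [Real.inv_rpow hp.le, Real.rpow_sub hp, Real.rpow_one]
          rfl
      _ ≤ s ^ (1 - t) :=
        Real.rpow_le_rpow_of_nonpos hs (B.slope_le x hx) (by linarith)
  refine (ENNReal.rpow_le_rpow key (by positivity)).trans (le_of_eq ?_)
  rw [lintegral_const_mul' _ _ ENNReal.ofReal_ne_top, ENNReal.mul_rpow_of_nonneg _ _ (by positivity),
    ENNReal.ofReal_rpow_of_pos (Real.rpow_pos_of_pos hs _), ← Real.rpow_mul hs.le]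
  congr 3
  field_simp

/-- The preimage of a null set under the inverse of a branch is a null set. -/
lemma ae_inv {q : ℝ → Prop} (h : ∀ᵐ z, q z) : ∀ᵐ x, x ∈ Ioo B.c B.d → q (B.inv x) := by
  have h0 : volume (T '' ({z | ¬ q z} ∩ Ioo B.a B.b)) = 0 :=
    addHaar_image_eq_zero_of_differentiableOn_of_addHaar_eq_zero _
      (fun z hz => (B.differentiableAt z hz.2).differentiableWithinAt)
      (measure_mono_null inter_subset_left h)
  filter_upwards [measure_eq_zero_iff_ae_notMem.1 h0] with x hx hxJ
  by_contra hc
  exact hx ⟨B.inv x, ⟨hc, B.mapsTo_inv hxJ⟩, B.right_inv x hxJ⟩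

/-- A function on the image of a branch, continued to the strips of width `r` on both sides by
reflection. -/
noncomputable def reflect (r : ℝ) (V : ℝ → ℝ≥0∞) (x : ℝ) : ℝ≥0∞ :=
  (Ioo (B.c - r) B.c).indicator (fun x => V (2 * B.c - x)) x
    + (Ioo B.d (B.d + r)).indicator (fun x => V (2 * B.d - x)) x

lemma measurable_reflect {V : ℝ → ℝ≥0∞} (hV : Measurable V) (r : ℝ) :
    Measurable (B.reflect r V) :=
  ((hV.comp (measurable_const.sub measurable_id)).indicator measurableSet_Ioo).add
    ((hV.comp (measurable_const.sub measurable_id)).indicator measurableSet_Ioo)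

/-- The strips are mirror images of `(c, c + r)` and `(d - r, d)`, which are disjoint because `2r ≤
d - c`. Hence the constant is `1` and not `2`. -/
lemma lintegralNorm_reflect_le {t r : ℝ} (ht : 1 ≤ t) (hr : 2 * r ≤ B.d - B.c)
    {V : ℝ → ℝ≥0∞} (hV : Measurable V) : lintegralNorm t (B.reflect r V) ≤ lintegralNorm t V := by
  have h0 : 0 < t := by linarith
  have hcd := B.c_lt_d
  refine ENNReal.rpow_le_rpow ?_ (by positivity)
  have hVt : Measurable fun x => V x ^ t := hV.pow_const t
  have m (c : ℝ) (J : Set ℝ) (hJ : MeasurableSet J) :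
      Measurable (J.indicator fun x => V (c - x) ^ t) :=
    (hVt.comp (measurable_const.sub measurable_id)).indicator hJ
  calc ∫⁻ x, B.reflect r V x ^ t
      = ∫⁻ x, ((Ioo (B.c - r) B.c).indicator (fun x => V (2 * B.c - x) ^ t) x
        + (Ioo B.d (B.d + r)).indicator (fun x => V (2 * B.d - x) ^ t) x) := by
        refine lintegral_congr fun x => ?_
        rw [← indicator_rpow_of_pos h0, ← indicator_rpow_of_pos h0, reflect]
        by_cases hx : x ∈ Ioo B.d (B.d + r)
        · have : x ∉ Ioo (B.c - r) B.c := fun h => by linarith [h.2, hx.1]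
          simp [this, ENNReal.zero_rpow_of_pos h0]
        · simp [hx, ENNReal.zero_rpow_of_pos h0]
    _ = (∫⁻ x, (Ioo (B.c - r) B.c).indicator (fun x => V (2 * B.c - x) ^ t) x)
        + ∫⁻ x, (Ioo B.d (B.d + r)).indicator (fun x => V (2 * B.d - x) ^ t) x :=
        lintegral_add_left (m _ _ measurableSet_Ioo) _
    _ = (∫⁻ x, (Ioo B.c (B.c + r)).indicator (fun x => V x ^ t) x)
        + ∫⁻ x, (Ioo (B.d - r) B.d).indicator (fun x => V x ^ t) x := by
        rw [← lintegral_sub_left_eq_self _ (2 * B.c),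
          ← lintegral_sub_left_eq_self ((Ioo (B.d - r) B.d).indicator _) (2 * B.d)]
        congr 1 <;>
        · refine lintegral_congr fun x => ?_
          simp only [indicator_apply, mem_Ioo, sub_sub_cancel]
          refine if_congr ?_ rfl rfl
          constructor <;> rintro ⟨h1, h2⟩ <;> constructor <;> linarith
    _ = ∫⁻ x, ((Ioo B.c (B.c + r)).indicator (fun x => V x ^ t) x
        + (Ioo (B.d - r) B.d).indicator (fun x => V x ^ t) x) :=
        (lintegral_add_left (hVt.indicator measurableSet_Ioo) _).symm
    _ ≤ ∫⁻ x, V x ^ t := by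
        refine lintegral_mono fun x => ?_
        by_cases hx : x ∈ Ioo (B.d - r) B.d
        · have : x ∉ Ioo B.c (B.c + r) := fun h => by linarith [h.2, hx.1]
          simp [this, hx]
        · simp only [hx, not_false_eq_true, indicator_of_notMem, add_zero]
          exact indicator_le_self' (fun _ _ => zero_le) _

/-- The relative distortion of a branch on sets of diameter `r / s`. -/
noncomputable def distortion (_B : ExpandingBranch T ε s M) (r : ℝ) : ℝ := M * (r / s) ^ ε / s

lemma distortion_nonneg {r : ℝ} (hr : 0 ≤ r) : 0 ≤ B.distortion r := by
  have := B.s_pos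
  have := B.M_nonneg
  unfold distortion
  positivity

lemma abs_inv_sub_le {x y ρ : ℝ} (hx : x ∈ Icc B.c B.d) (hy : y ∈ Icc B.c B.d)
    (h : |x - y| ≤ ρ) : |B.inv x - B.inv y| ≤ ρ / s := by
  rw [le_div_iff₀' B.s_pos]
  exact (B.dist_inv x hx y hy).trans h

lemma abs_inv_sub_lt {x y ρ : ℝ} (hx : x ∈ Icc B.c B.d) (hy : y ∈ Icc B.c B.d)
    (h : |x - y| < ρ) : |B.inv x - B.inv y| < ρ / s := by
  rw [lt_div_iff₀' B.s_pos]
  exact (B.dist_inv x hx y hy).trans_lt h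

/-- The splitting `w₁ g₁ - w₂ g₂ = w₁ (g₁ - g₂) + (w₁ - w₂) g₂`. The centre `x` need not be the one
where the oscillation is taken, and the separation `ρ` is independent of `r`; it will be `r` after a
reflection and `2r` otherwise. -/
lemma enorm_transfer_sub_le (g : I → ℂ) {r ρ x : ℝ} {y₁ y₂ : I}
    (hx : x ∈ Ioo B.c B.d) (h₁ : (y₁ : ℝ) ∈ Ioo B.c B.d) (h₂ : (y₂ : ℝ) ∈ Ioo B.c B.d)
    (d₁ : |y₁ - x| < r) (d₂ : |y₂ - x| < r) (hρ : |(y₁ : ℝ) - y₂| ≤ ρ) :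
    ‖B.transfer g y₁ - B.transfer g y₂‖ₑ
      ≤ ENNReal.ofReal (1 + B.distortion r) * B.pull (zeroExt (bvOsc g (r / s))) x
        + ENNReal.ofReal (M * (ρ / s) ^ ε * |deriv T (B.inv y₁)|⁻¹ * |deriv T (B.inv y₂)|⁻¹)
          * ‖g ⟨B.inv y₂, B.mem_unitInterval (B.mapsTo_inv h₂)⟩‖ₑ := by
  have hs := B.s_pos
  have hr : 0 < r := (abs_nonneg _).trans_lt d₁
  have i {x} (h : x ∈ Ioo B.c B.d) := Ioo_subset_Icc_self h
  rw [B.transfer_of_mem g h₁, B.transfer_of_mem g h₂]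
  set w₁ := |deriv T (B.inv y₁)|⁻¹ with hw₁
  set w₂ := |deriv T (B.inv y₂)|⁻¹ with hw₂
  have hw₁0 : 0 ≤ w₁ := by positivity
  set z₁ : I := ⟨B.inv y₁, B.mem_unitInterval (B.mapsTo_inv h₁)⟩
  set z₂ : I := ⟨B.inv y₂, B.mem_unitInterval (B.mapsTo_inv h₂)⟩
  have hz : g z₁ * (w₁ : ℂ) - g z₂ * (w₂ : ℂ)
      = (w₁ : ℂ) * (g z₁ - g z₂) + ((w₁ - w₂ : ℝ) : ℂ) * g z₂ := by
    push_cast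
    ring
  have en (u : ℝ) : ‖(u : ℂ)‖ₑ = ENNReal.ofReal |u| := by
    rw [← ofReal_norm, Complex.norm_real, Real.norm_eq_abs]
  rw [hz]
  refine (enorm_add_le _ _).trans ?_
  rw [enorm_mul, enorm_mul, en, en, abs_of_nonneg hw₁0]
  gcongr ?_ + ENNReal.ofReal ?_ * _
  · rw [pull, indicator_of_mem hx, zeroExt_of_mem _ (B.mem_unitInterval (B.mapsTo_inv hx)),
      ← mul_assoc, ← ENNReal.ofReal_mul (by have := B.distortion_nonneg hr.le; positivity)]
    gcongr
    · exact B.weight_le_mul (B.mapsTo_inv h₁) (B.mapsTo_inv hx)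
        (B.abs_inv_sub_le (i h₁) (i hx) d₁.le)
    · exact enorm_sub_le_bvOsc g (B.abs_inv_sub_lt (i h₁) (i hx) d₁)
        (B.abs_inv_sub_lt (i h₂) (i hx) d₂)
  · exact B.abs_weight_sub_le (B.mapsTo_inv h₁) (B.mapsTo_inv h₂)
      (B.abs_inv_sub_le (i h₁) (i h₂) hρ)

lemma enorm_transfer_le_supNear (g : I → ℂ) {A e : ℝ} {y : I} (hy : (y : ℝ) ∈ Ioo B.c B.d)
    (he : e ∈ Icc B.c B.d) (h : |(y : ℝ) - e| < 2 * A) :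
    ‖g ⟨B.inv y, B.mem_unitInterval (B.mapsTo_inv hy)⟩‖ₑ ≤ supNear g (2 * A) (B.inv e) := by
  refine enorm_le_supNear g ((B.abs_inv_sub_lt (Ioo_subset_Icc_self hy) he h).trans_le ?_)
  exact div_le_self ((abs_nonneg _).trans h.le) B.one_lt_s.le

/-- The part of the bound for the oscillation that comes from the ends of the image. -/
noncomputable def strips (g : I → ℂ) (A r : ℝ) (x : ℝ) : ℝ≥0∞ :=
  (Metric.ball B.c r).indicator (fun _ => supNear g (2 * A) (B.inv B.c)) x
    + (Metric.ball B.d r).indicator (fun _ => supNear g (2 * A) (B.inv B.d)) x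

lemma measurable_strips (g : I → ℂ) (A r : ℝ) : Measurable (B.strips g A r) :=
  (measurable_const.indicator Metric.isOpen_ball.measurableSet).add
    (measurable_const.indicator Metric.isOpen_ball.measurableSet)

lemma le_strips_left (g : I → ℂ) {A r x : ℝ} {y : I} (hy : (y : ℝ) ∈ Ioo B.c B.d)
    (h : |(y : ℝ) - B.c| < 2 * A) (hx : |x - B.c| < r) :
    ‖g ⟨B.inv y, B.mem_unitInterval (B.mapsTo_inv hy)⟩‖ₑ ≤ B.strips g A r x := by
  rw [strips, indicator_of_mem (show x ∈ Metric.ball B.c r from hx)]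
  exact (B.enorm_transfer_le_supNear g hy ⟨le_rfl, B.c_lt_d.le⟩ h).trans le_self_add

lemma le_strips_right (g : I → ℂ) {A r x : ℝ} {y : I} (hy : (y : ℝ) ∈ Ioo B.c B.d)
    (h : |(y : ℝ) - B.d| < 2 * A) (hx : |x - B.d| < r) :
    ‖g ⟨B.inv y, B.mem_unitInterval (B.mapsTo_inv hy)⟩‖ₑ ≤ B.strips g A r x := by
  rw [strips, indicator_of_mem (show x ∈ Metric.ball B.d r from hx)]
  exact (B.enorm_transfer_le_supNear g hy ⟨B.c_lt_d.le, le_rfl⟩ h).trans le_add_self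

/-- If `y` lies in `(c, d)` and `y'` does not, an end of the image separates them. Then `y` is
within `2r ≤ 2A` of that end and `x` within `r` of it. -/
lemma enorm_transfer_le_strips (g : I → ℂ) {A r x : ℝ} {y y' : I} (hrA : r ≤ A)
    (h : |y - x| < r) (h' : |y' - x| < r) (hy' : (y' : ℝ) ∉ Ioo B.c B.d) :
    ‖B.transfer g y‖ₑ ≤ ENNReal.ofReal (1 / s) * B.strips g A r x := by
  by_cases hy : (y : ℝ) ∈ Ioo B.c B.d
  · have hw : ‖((|deriv T (B.inv y)|⁻¹ : ℝ) : ℂ)‖ₑ ≤ ENNReal.ofReal (1 / s) := by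
      rw [← ofReal_norm, Complex.norm_real, Real.norm_of_nonneg (by positivity)]
      exact ENNReal.ofReal_le_ofReal (B.weight_le (B.mapsTo_inv hy))
    rw [B.transfer_of_mem g hy, enorm_mul, mul_comm]
    refine mul_le_mul' hw ?_
    rw [abs_lt] at h h'
    rcases le_or_gt (y' : ℝ) B.c with hc | hc
    · refine B.le_strips_left g hy ?_ ?_ <;> rw [abs_lt] <;> constructor <;>
        linarith [hy.1, hy.2]
    · have hd : B.d ≤ y' := not_lt.1 fun hd => hy' ⟨hc, hd⟩
      refine B.le_strips_right g hy ?_ ?_ <;> rw [abs_lt] <;> constructor <;>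
        linarith [hy.1, hy.2]
  · rw [B.transfer_of_notMem g hy, enorm_zero]
    exact zero_le

/-- The pointwise bound for the oscillation of the contribution of a branch. -/
noncomputable def oscBound (g : I → ℂ) (u : I → ℝ≥0∞) (A r : ℝ) (x : ℝ) : ℝ≥0∞ :=
  ENNReal.ofReal ((1 + B.distortion r) * (1 + 2 ^ ε * B.distortion r))
      * B.pull (zeroExt (bvOsc g (r / s))) x
    + ENNReal.ofReal (2 ^ ε * B.distortion r * (1 + B.distortion r)) * B.pull (zeroExt u) x
    + ENNReal.ofReal (1 + B.distortion r)
      * B.reflect r (B.pull (zeroExt (bvOsc g (r / s)))) x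
    + ENNReal.ofReal ((1 + B.distortion r) / s) * B.strips g A r x

/-- The function `u` is a measurable substitute for `|g|`, so only its value at the preimage of `x`
is compared with `|g|`. The two ends of the image are excluded, a null set. -/
lemma bvOsc_transfer_le (g : I → ℂ) (u : I → ℝ≥0∞) {A r : ℝ} (hrA : r ≤ A)
    (hrJ : 2 * r ≤ B.d - B.c) {x : I} (hc : (x : ℝ) ≠ B.c) (hd : (x : ℝ) ≠ B.d)
    (hu : ∀ hx : (x : ℝ) ∈ Ioo B.c B.d,
      ‖g ⟨B.inv x, B.mem_unitInterval (B.mapsTo_inv hx)⟩‖ₑ ≤ zeroExt u (B.inv x)) :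
    bvOsc (B.transfer g) r x ≤ B.oscBound g u A r x := by
  have hs := B.s_pos
  have hM := B.M_nonneg
  have hcd := B.c_lt_d
  refine iSup₂_le fun y₁ h₁ => iSup₂_le fun y₂ h₂ => ?_
  have k₁ : |(y₁ : ℝ) - x| < r := h₁
  have k₂ : |(y₂ : ℝ) - x| < r := h₂
  have hr : 0 < r := (abs_nonneg _).trans_lt k₁
  set δ := B.distortion r with hδ
  have hδ0 : 0 ≤ δ := B.distortion_nonneg hr.le
  have hstrip : ENNReal.ofReal (1 / s) * B.strips g A r x ≤ B.oscBound g u A r x := by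
    refine le_trans ?_ le_add_self
    gcongr
    linarith
  by_cases j₂ : (y₂ : ℝ) ∈ Ioo B.c B.d
  swap
  · rw [B.transfer_of_notMem g j₂, sub_zero]
    exact (B.enorm_transfer_le_strips g hrA k₁ k₂ j₂).trans hstrip
  by_cases j₁ : (y₁ : ℝ) ∈ Ioo B.c B.d
  swap
  · rw [B.transfer_of_notMem g j₁, zero_sub, enorm_neg]
    exact (B.enorm_transfer_le_strips g hrA k₂ k₁ j₁).trans hstrip
  have hdist : ∀ {ρ : ℝ}, |(y₁ : ℝ) - y₂| ≤ ρ → ρ ≤ r →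
      ENNReal.ofReal (M * (ρ / s) ^ ε * |deriv T (B.inv y₁)|⁻¹ * |deriv T (B.inv y₂)|⁻¹)
        ≤ ENNReal.ofReal (δ / s) := by
    intro ρ hρ hρr
    refine ENNReal.ofReal_le_ofReal ?_
    have hρ0 : 0 ≤ ρ := (abs_nonneg _).trans hρ
    calc M * (ρ / s) ^ ε * |deriv T (B.inv y₁)|⁻¹ * |deriv T (B.inv y₂)|⁻¹
        ≤ M * (r / s) ^ ε * (1 / s) * (1 / s) := by
          have := B.weight_le (B.mapsTo_inv j₁)
          have := B.weight_le (B.mapsTo_inv j₂)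
          have := B.ε_pos
          gcongr
      _ = δ / s := by
        rw [hδ, distortion]
        ring
  -- Case `x` outside the image, with mirror image `x'` inside. Both test points lie on the same
  -- side of the end, hence within `r` of each other and of `x'`. The value of `g` in the error term
  -- is absorbed by the strips.
  have houter : ∀ x' : ℝ, x' ∈ Ioo B.c B.d → |(y₁ : ℝ) - x'| < r → |(y₂ : ℝ) - x'| < r →
      |(y₁ : ℝ) - y₂| ≤ r →
      B.pull (zeroExt (bvOsc g (r / s))) x'
        ≤ B.reflect r (B.pull (zeroExt (bvOsc g (r / s)))) x →
      ‖g ⟨B.inv y₂, B.mem_unitInterval (B.mapsTo_inv j₂)⟩‖ₑ ≤ B.strips g A r x →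
      ‖B.transfer g y₁ - B.transfer g y₂‖ₑ ≤ B.oscBound g u A r x := by
    intro x' hx' l₁ l₂ l hV hS
    refine (B.enorm_transfer_sub_le g hx' j₁ j₂ l₁ l₂ l).trans ?_
    rw [oscBound, add_assoc _ (_ * B.reflect _ _ _)]
    refine le_trans ?_ le_add_self
    refine add_le_add (mul_le_mul' le_rfl hV) (mul_le_mul' ((hdist l le_rfl).trans ?_) hS)
    gcongr
    linarith
  rw [abs_lt] at k₁ k₂
  rcases lt_or_gt_of_ne hc with hxc | hxc
  · refine houter (2 * B.c - x) ⟨by linarith, by linarith [j₁.1]⟩ ?_ ?_ ?_ ?_ ?_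
    · rw [abs_lt]; constructor <;> linarith [j₁.1]
    · rw [abs_lt]; constructor <;> linarith [j₂.1]
    · rw [abs_le]; constructor <;> linarith [j₁.1, j₂.1]
    · rw [reflect, indicator_of_mem (show (x : ℝ) ∈ Ioo (B.c - r) B.c from
        ⟨by linarith [j₁.1], hxc⟩)]
      exact le_self_add
    · refine B.le_strips_left g j₂ ?_ ?_ <;> rw [abs_lt] <;> constructor <;> linarith [j₂.1]
  rcases lt_or_gt_of_ne hd with hxd | hxd
  swap
  · refine houter (2 * B.d - x) ⟨by linarith [j₁.2], by linarith⟩ ?_ ?_ ?_ ?_ ?_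
    · rw [abs_lt]; constructor <;> linarith [j₁.2]
    · rw [abs_lt]; constructor <;> linarith [j₂.2]
    · rw [abs_le]; constructor <;> linarith [j₁.2, j₂.2]
    · rw [reflect, indicator_of_mem (show (x : ℝ) ∈ Ioo B.d (B.d + r) from
        ⟨hxd, by linarith [j₁.2]⟩)]
      exact le_add_self
    · refine B.le_strips_right g j₂ ?_ ?_ <;> rw [abs_lt] <;> constructor <;> linarith [j₂.2]
  have hxJ : (x : ℝ) ∈ Ioo B.c B.d := ⟨hxc, hxd⟩
  rw [← abs_lt] at k₁ k₂
  have l : |(y₁ : ℝ) - y₂| ≤ 2 * r := by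
    rw [abs_lt] at k₁ k₂
    rw [abs_le]; constructor <;> linarith
  refine (B.enorm_transfer_sub_le g hxJ j₁ j₂ k₁ k₂ l).trans ?_
  rw [oscBound, ← hδ, add_assoc _ (_ * B.reflect _ _ _)]
  refine le_trans ?_ le_self_add
  -- The factor `2 ^ ε` comes from the separation `2r`. One weight is transferred to `x` at the
  -- price `1 + δ`, the other bounded by `1/s`.
  have hw : M * (2 * r / s) ^ ε * |deriv T (B.inv y₁)|⁻¹ * |deriv T (B.inv y₂)|⁻¹
      ≤ 2 ^ ε * δ * (1 + δ) * |deriv T (B.inv x)|⁻¹ := by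
    have e : M * (2 * r / s) ^ ε = 2 ^ ε * (δ * s) := by
      rw [hδ, distortion, mul_div_assoc, Real.mul_rpow zero_le_two (by positivity)]
      field_simp
    rw [e]
    calc 2 ^ ε * (δ * s) * |deriv T (B.inv y₁)|⁻¹ * |deriv T (B.inv y₂)|⁻¹
        ≤ 2 ^ ε * (δ * s) * ((1 + δ) * |deriv T (B.inv x)|⁻¹) * (1 / s) := by
          gcongr
          · exact B.weight_le_mul (B.mapsTo_inv j₁) (B.mapsTo_inv hxJ) (B.abs_inv_sub_le
              (Ioo_subset_Icc_self j₁) (Ioo_subset_Icc_self hxJ) k₁.le)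
          · exact B.weight_le (B.mapsTo_inv j₂)
      _ = _ := by field_simp
  have hg : ‖g ⟨B.inv y₂, B.mem_unitInterval (B.mapsTo_inv j₂)⟩‖ₑ
      ≤ zeroExt u (B.inv x) + zeroExt (bvOsc g (r / s)) (B.inv x) := by
    refine (enorm_le_enorm_add_bvOsc g (div_pos hr hs)
      (x := ⟨B.inv x, B.mem_unitInterval (B.mapsTo_inv hxJ)⟩) (B.abs_inv_sub_lt
      (Ioo_subset_Icc_self j₂) (Ioo_subset_Icc_self hxJ) k₂)).trans ?_
    rw [zeroExt_of_mem (bvOsc g (r / s)) (B.mem_unitInterval (B.mapsTo_inv hxJ))]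
    exact add_le_add_left (hu hxJ) _
  refine (add_le_add_right (mul_le_mul' (ENNReal.ofReal_le_ofReal hw) hg) _).trans ?_
  rw [pull, pull, indicator_of_mem hxJ, indicator_of_mem hxJ,
    show (1 + δ) * (1 + 2 ^ ε * δ) = (1 + δ) + 2 ^ ε * δ * (1 + δ) by ring,
    ENNReal.ofReal_add (p := 1 + δ) (q := 2 ^ ε * δ * (1 + δ)) (by positivity) (by positivity),
    ENNReal.ofReal_mul (p := 2 ^ ε * δ * (1 + δ)) (by positivity)]
  refine le_of_eq ?_
  ring

end ExpandingBranch

/-! ### Constructing a branch from a continuous extension. -/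

/-- A map with slope at least `s` on an open interval, which extends continuously to the closed
interval, is an expanding branch there. -/
theorem ExpandingBranch.exists_of_extension {T φ : ℝ → ℝ} {ε s M a b : ℝ} (ha : 0 ≤ a)
    (hab : a < b) (hb : b ≤ 1) (hs : 1 < s) (hM : 0 ≤ M) (hε : 0 < ε)
    (hφ : ContinuousOn φ (Icc a b)) (hT : EqOn T φ (Ioo a b))
    (slope : ∀ z ∈ Ioo a b, s ≤ |deriv T z|)
    (holder : ∀ x ∈ Ioo a b, ∀ y ∈ Ioo a b, |deriv T x - deriv T y| ≤ M * |x - y| ^ ε) :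
    ∃ B : ExpandingBranch T ε s M, B.a = a ∧ B.b = b := by
  have hs0 : 0 < s := by linarith
  -- `deriv` is `0` where a function is not differentiable, so the slope bound already implies
  -- differentiability.
  have hdiff : ∀ z ∈ Ioo a b, DifferentiableAt ℝ T z := fun z hz =>
    differentiableAt_of_deriv_ne_zero fun h => by
      have := slope z hz
      rw [h, abs_zero] at this
      linarith
  have hev : ∀ z ∈ Ioo a b, T =ᶠ[nhds z] φ := fun z hz =>
    Filter.eventuallyEq_of_mem (isOpen_Ioo.mem_nhds hz) hT
  -- The mean value theorem turns the slope bound into expansion on the closed interval;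
  -- injectivity, strict monotonicity and the Lipschitz inverse all follow from it.
  have hlt : ∀ u ∈ Icc a b, ∀ v ∈ Icc a b, u < v → s * |u - v| ≤ |φ u - φ v| := by
    intro u hu v hv huv
    obtain ⟨z, hz, hzd⟩ := exists_deriv_eq_slope φ huv (hφ.mono (Icc_subset_Icc hu.1 hv.2))
      fun w hw => ((hdiff w ⟨hu.1.trans_lt hw.1, hw.2.trans_le hv.2⟩).congr_of_eventuallyEq
        (hev w ⟨hu.1.trans_lt hw.1, hw.2.trans_le hv.2⟩).symm).differentiableWithinAt
    have hz' : z ∈ Ioo a b := ⟨hu.1.trans_lt hz.1, hz.2.trans_le hv.2⟩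
    have h := slope z hz'
    rw [(hev z hz').deriv_eq, hzd, abs_div, le_div_iff₀ (abs_pos.2 (sub_pos.2 huv).ne')] at h
    rwa [abs_sub_comm u, abs_sub_comm (φ u)]
  have hexp : ∀ u ∈ Icc a b, ∀ v ∈ Icc a b, s * |u - v| ≤ |φ u - φ v| := by
    intro u hu v hv
    rcases lt_trichotomy u v with h | rfl | h
    · exact hlt u hu v hv h
    · simp
    · rw [abs_sub_comm u, abs_sub_comm (φ u)]
      exact hlt v hv u hu h
  have hinj : InjOn φ (Icc a b) := fun u hu v hv huv => by
    have h := hexp u hu v hv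
    rw [huv, sub_self, abs_zero] at h
    have h' : |u - v| = 0 := le_antisymm (by nlinarith [abs_nonneg (u - v)]) (abs_nonneg _)
    exact sub_eq_zero.1 (abs_eq_zero.1 h')
  have la : a ∈ Icc a b := ⟨le_rfl, hab.le⟩
  have lb : b ∈ Icc a b := ⟨hab.le, le_rfl⟩
  obtain ⟨c, d, hcd, hends, hmaps, hsurj⟩ : ∃ c d, c < d ∧ (φ a = c ∧ φ b = d ∨ φ a = d ∧ φ b = c) ∧
      MapsTo φ (Ioo a b) (Ioo c d) ∧ Icc c d ⊆ φ '' Icc a b := by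
    rcases hφ.strictMonoOn_of_injOn_Icc' hab.le hinj with h | h
    · exact ⟨φ a, φ b, h la lb hab, .inl ⟨rfl, rfl⟩, fun z hz =>
        ⟨h la (Ioo_subset_Icc_self hz) hz.1, h (Ioo_subset_Icc_self hz) lb hz.2⟩,
        intermediate_value_Icc hab.le hφ⟩
    · exact ⟨φ b, φ a, h la lb hab, .inr ⟨rfl, rfl⟩, fun z hz =>
        ⟨h (Ioo_subset_Icc_self hz) lb hz.2, h la (Ioo_subset_Icc_self hz) hz.1⟩,
        intermediate_value_Icc' hab.le hφ⟩
  choose ψ hψ hφψ using fun x : Icc c d => hsurj x.2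
  have hdist : ∀ x y : Icc c d, s * |ψ x - ψ y| ≤ |(x : ℝ) - y| := fun x y => by
    have := hexp _ (hψ x) _ (hψ y)
    rwa [hφψ, hφψ] at this
  have hcont : Continuous ψ := by
    refine (LipschitzWith.of_dist_le_mul (K := 1) fun x y => ?_).continuous
    rw [NNReal.coe_one, one_mul, Real.dist_eq]
    exact (le_mul_of_one_le_left (abs_nonneg _) hs.le).trans (hdist x y)
  have hψφ : ∀ z ∈ Icc a b, ∀ hz : φ z ∈ Icc c d, ψ ⟨φ z, hz⟩ = z := fun z hz h =>
    hinj (hψ _) hz (hφψ _)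
  have hcI : c ∈ Icc c d := ⟨le_rfl, hcd.le⟩
  have hdI : d ∈ Icc c d := ⟨hcd.le, le_rfl⟩
  have hproj : ∀ x (hx : x ∈ Icc c d), IccExtend hcd.le ψ x = ψ ⟨x, hx⟩ := fun x hx =>
    IccExtend_of_mem _ _ hx
  have hmapsinv : MapsTo (IccExtend hcd.le ψ) (Ioo c d) (Ioo a b) := by
    intro x hx
    rw [hproj x (Ioo_subset_Icc_self hx)]
    have h1 := hψ ⟨x, Ioo_subset_Icc_self hx⟩
    have h2 := hφψ ⟨x, Ioo_subset_Icc_self hx⟩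
    have hne : φ a ≠ x ∧ φ b ≠ x := by
      rcases hends with ⟨e1, e2⟩ | ⟨e1, e2⟩ <;> rw [e1, e2]
      · exact ⟨hx.1.ne, hx.2.ne'⟩
      · exact ⟨hx.2.ne', hx.1.ne⟩
    refine ⟨lt_of_le_of_ne h1.1 fun h => hne.1 ?_, lt_of_le_of_ne h1.2 fun h => hne.2 ?_⟩
    · rw [h, h2]
    · rw [← h, h2]
  refine ⟨{
    a := a, b := b, c := c, d := d, inv := IccExtend hcd.le ψ
    a_nonneg := ha, a_lt_b := hab, b_le_one := hb, c_lt_d := hcd, one_lt_s := hs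
    M_nonneg := hM, ε_pos := hε, differentiableAt := hdiff
    mapsTo := fun z hz => by rw [hT hz]; exact hmaps hz
    mapsTo_inv := hmapsinv
    left_inv := fun z hz => by
      have h := Ioo_subset_Icc_self (hmaps hz)
      rw [hT hz, hproj _ h, hψφ z (Ioo_subset_Icc_self hz) h]
    right_inv := fun x hx => by
      rw [hT (hmapsinv hx), hproj x (Ioo_subset_Icc_self hx), hφψ]
    continuous_inv := hcont.Icc_extend'
    dist_inv := fun x hx y hy => by
      rw [hproj x hx, hproj y hy]
      exact hdist ⟨x, hx⟩ ⟨y, hy⟩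
    inv_ends := by
      rw [hproj c hcI, hproj d hdI]
      rcases hends with ⟨e1, e2⟩ | ⟨e1, e2⟩
      · subst e1 e2
        exact .inl ⟨hψφ a la hcI, hψφ b lb hdI⟩
      · subst e1 e2
        exact .inr ⟨hψφ b lb hcI, hψφ a la hdI⟩
    slope_le := slope
    holder := holder }, rfl, rfl⟩

/-! ### Decomposition of the operator into branches. -/

namespace ExpandingPartition

variable {ε : ℝ} {τ : I → I} (P : ExpandingPartition ε τ)

lemma q_ne_zero : P.q ≠ 0 := by
  intro h
  have h1 : (0 : Fin (P.q + 1)) = Fin.last P.q := by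
    ext
    simp [h]
  have := P.a_last
  rw [← h1, P.a_zero] at this
  exact zero_ne_one this

instance : NeZero P.q := ⟨P.q_ne_zero⟩

lemma a_mem (j : Fin (P.q + 1)) : P.a j ∈ Icc (0 : ℝ) 1 :=
  ⟨P.a_zero ▸ P.strictMono_a.monotone (Fin.zero_le j),
    P.a_last ▸ P.strictMono_a.monotone (Fin.le_last j)⟩

lemma a_lt (i : Fin P.q) : P.a i.castSucc < P.a i.succ := P.strictMono_a i.castSucc_lt_succ

lemma s_le (i : Fin P.q) : P.s ≤ P.slope i := ciInf_le (Finite.bddBelow_range _) i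

lemma one_lt_s : 1 < P.s := by
  obtain ⟨i, hi⟩ := exists_eq_ciInf_of_finite (f := P.slope)
  rw [s, ← hi]
  exact P.one_lt_slope i

lemma holderConst_le (i : Fin P.q) : P.holderConst i ≤ P.M := le_ciSup (Finite.bddAbove_range _) i

/-- The Hölder inequality at two distinct points forces a nonnegative constant. -/
lemma M_nonneg : 0 ≤ P.M := by
  refine le_trans ?_ (P.holderConst_le 0)
  obtain ⟨x, hx1, hx2⟩ := exists_between (P.a_lt 0)
  obtain ⟨y, hy1, hy2⟩ := exists_between hx2
  have h := (abs_nonneg _).trans (P.holder 0 x ⟨hx1, hx2⟩ y ⟨hx1.trans hy1, hy2⟩)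
  exact nonneg_of_mul_nonneg_left h
    (Real.rpow_pos_of_pos (abs_pos.2 (sub_neg.2 hy1).ne) _)

lemma exists_branch (hε : 0 < ε) (i : Fin P.q) :
    ∃ B : ExpandingBranch (intervalMapExt τ) ε P.s P.M,
      B.a = P.a i.castSucc ∧ B.b = P.a i.succ := by
  obtain ⟨φ, hφ, hT⟩ := P.exists_extension i
  refine ExpandingBranch.exists_of_extension (P.a_mem _).1 (P.a_lt i) (P.a_mem _).2 P.one_lt_s
    P.M_nonneg hε hφ.continuousOn hT (fun z hz => (P.s_le i).trans (P.slope_le i z hz))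
    fun x hx y hy => (P.holder i x hx y hy).trans ?_
  gcongr
  exact P.holderConst_le i

/-- The branch on the interval `(a_i, a_{i+1})` of the partition. -/
noncomputable def branch (hε : 0 < ε) (i : Fin P.q) :
    ExpandingBranch (intervalMapExt τ) ε P.s P.M := (P.exists_branch hε i).choose

lemma branch_a (hε : 0 < ε) (i : Fin P.q) : (P.branch hε i).a = P.a i.castSucc :=
  (P.exists_branch hε i).choose_spec.1

lemma branch_b (hε : 0 < ε) (i : Fin P.q) : (P.branch hε i).b = P.a i.succ :=
  (P.exists_branch hε i).choose_spec.2

/-- The sum of the contributions of the branches to the Frobenius-Perron operator. -/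
noncomputable def transfer (hε : 0 < ε) (g : I → ℂ) (x : I) : ℂ :=
  ∑ i, (P.branch hε i).transfer g x

lemma exists_mem_Ioo {y : I} (hy : ∀ j, (y : ℝ) ≠ P.a j) :
    ∃ i : Fin P.q, (y : ℝ) ∈ Ioo (P.a i.castSucc) (P.a i.succ) := by
  have h0 : P.a 0 < y := lt_of_le_of_ne (P.a_zero ▸ y.2.1) (hy 0).symm
  obtain ⟨j, hj, hmax⟩ := (Set.toFinite {j | P.a j < y}).exists_maximalFor P.a _ ⟨0, h0⟩
  induction j using Fin.lastCases with
  | last =>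
    have : P.a (Fin.last _) < y := hj
    rw [P.a_last] at this
    exact absurd y.2.2 (not_le.2 this)
  | cast i =>
    refine ⟨i, hj, lt_of_not_ge fun h => ?_⟩
    have h' : P.a i.succ < y := lt_of_le_of_ne h (hy _).symm
    exact (hmax h' (P.a_lt i).le).not_gt (P.a_lt i)

lemma disjoint_Ioo {i j : Fin P.q} (hij : i ≠ j) :
    Disjoint (Ioo (P.a i.castSucc) (P.a i.succ)) (Ioo (P.a j.castSucc) (P.a j.succ)) := by
  rw [Set.disjoint_left]
  intro y hi hj
  rcases lt_or_gt_of_ne hij with h | h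
  · exact absurd (hi.2.trans_le (P.strictMono_a.monotone (Fin.succ_le_castSucc_iff.2 h)))
      (not_lt.2 hj.1.le)
  · exact absurd (hj.2.trans_le (P.strictMono_a.monotone (Fin.succ_le_castSucc_iff.2 h)))
      (not_lt.2 hi.1.le)

/-- When `x` avoids the images of the partition points, its fibre splits into one piece per
interval, each empty or the single point given by the inverse branch. -/
lemma frobeniusPerron_eq (hε : 0 < ε) (f : I → ℂ) {x : I}
    (hx : ∀ j, x ≠ τ ⟨P.a j, P.a_mem j⟩) : frobeniusPerron τ f x = P.transfer hε f x := by
  have hτ (y : I) : intervalMapExt τ y = τ y := IccExtend_val _ _ y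
  set S : Fin P.q → Set I := fun i =>
    {y | (y : ℝ) ∈ Ioo (P.branch hε i).a (P.branch hε i).b ∧ τ y = x} with hS
  have hcover : {y | τ y = x} = ⋃ i, S i := by
    ext y
    simp only [mem_ofPred_eq, mem_iUnion, hS]
    refine ⟨fun h => ?_, fun ⟨_, _, h⟩ => h⟩
    obtain ⟨i, hi⟩ := P.exists_mem_Ioo (y := y) fun j hj => hx j (by
      rw [← h]
      congr 1
      exact Subtype.ext hj)
    exact ⟨i, by rwa [P.branch_a, P.branch_b], h⟩
  have hsing (i : Fin P.q) : (∃ hx : (x : ℝ) ∈ Ioo (P.branch hε i).c (P.branch hε i).d,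
        S i = {⟨(P.branch hε i).inv x,
          (P.branch hε i).mem_unitInterval ((P.branch hε i).mapsTo_inv hx)⟩}) ∨
      ((x : ℝ) ∉ Ioo (P.branch hε i).c (P.branch hε i).d ∧ S i = ∅) := by
    set B := P.branch hε i
    by_cases hxJ : (x : ℝ) ∈ Ioo B.c B.d
    · refine .inl ⟨hxJ, ?_⟩
      ext y
      simp only [hS, mem_ofPred_eq, mem_singleton_iff]
      constructor
      · rintro ⟨hy, rfl⟩
        refine Subtype.ext ?_
        have h := B.left_inv _ hy
        rw [hτ] at h
        exact h.symm
      · rintro rfl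
        refine ⟨B.mapsTo_inv hxJ, Subtype.ext ?_⟩
        rw [← hτ]
        exact B.right_inv x hxJ
    · refine .inr ⟨hxJ, eq_empty_of_forall_notMem ?_⟩
      rintro y ⟨hy, rfl⟩
      exact hxJ (hτ y ▸ B.mapsTo hy)
  -- Finiteness matters: `finsum` takes the value `0` on infinite supports.
  have hfin : ∀ i, (S i).Finite := fun i => by
    rcases hsing i with ⟨_, h⟩ | ⟨_, h⟩ <;> rw [h] <;> simp
  have hdisj : Pairwise (Function.onFun Disjoint S) := fun i j hij => by
    refine Set.disjoint_left.2 fun y hi hj =>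
      (P.disjoint_Ioo hij).notMem_of_mem_left (a := (y : ℝ)) ?_ ?_
    · simpa only [P.branch_a, P.branch_b] using hi.1
    · simpa only [P.branch_a, P.branch_b] using hj.1
  have h1 : frobeniusPerron τ f x
      = ∑ᶠ (y : I) (_ : y ∈ ⋃ i, S i), f y * ((|intervalMapDeriv τ y|⁻¹ : ℝ) : ℂ) := by
    rw [← hcover]
    rfl
  rw [h1, finsum_mem_iUnion hdisj hfin, finsum_eq_sum_of_fintype, transfer]
  refine Finset.sum_congr rfl fun i _ => ?_
  rcases hsing i with ⟨hxJ, h⟩ | ⟨hxJ, h⟩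
  · rw [h, finsum_mem_singleton, ExpandingBranch.transfer_of_mem _ _ hxJ]
    rfl
  · rw [h, finsum_mem_empty, ExpandingBranch.transfer_of_notMem _ _ hxJ]

end ExpandingPartition

lemma ae_unitInterval_of_ae {q : ℝ → Prop} (h : ∀ᵐ x, q x) : ∀ᵐ x : I, q x := by
  rw [unitInterval.volume_def]
  exact (ae_restrict_iff_subtype measurableSet_Icc).1 (ae_restrict_of_ae h)

lemma ae_of_ae_unitInterval {q : I → Prop} (h : ∀ᵐ x : I, q x) :
    ∀ᵐ x : ℝ, x ∈ Icc (0 : ℝ) 1 → q (projIcc 0 1 zero_le_one x) := by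
  rw [← ae_restrict_iff' measurableSet_Icc]
  refine (ae_restrict_iff_subtype measurableSet_Icc).2 ?_
  simpa [unitInterval.volume_def] using h

namespace ExpandingPartition

variable {ε : ℝ} {τ : I → I} (P : ExpandingPartition ε τ)

/-- Differentiable branches send null sets to null sets, so the inverse branches cannot see a change
of `g` on a null set. -/
lemma transfer_congr_ae (hε : 0 < ε) {f g : I → ℂ} (h : g =ᵐ[volume] f) :
    P.transfer hε g =ᵐ[volume] P.transfer hε f := by
  have h1 := ae_of_ae_unitInterval h
  have h2 := ae_unitInterval_of_ae (ae_all_iff.2 fun i => (P.branch hε i).ae_inv h1)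
  filter_upwards [h2] with x hx
  refine Finset.sum_congr rfl fun i _ => ?_
  set B := P.branch hε i
  by_cases hxJ : (x : ℝ) ∈ Ioo B.c B.d
  · rw [ExpandingBranch.transfer, ExpandingBranch.transfer, indicator_of_mem hxJ,
      indicator_of_mem hxJ, hx i hxJ (B.mem_unitInterval (B.mapsTo_inv hxJ))]
  · rw [B.transfer_of_notMem _ hxJ, B.transfer_of_notMem _ hxJ]

lemma frobeniusPerron_ae_eq (hε : 0 < ε) {f g : I → ℂ} (h : g =ᵐ[volume] f) :
    P.transfer hε g =ᵐ[volume] frobeniusPerron τ f := by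
  refine (P.transfer_congr_ae hε h).trans ?_
  have h1 : ∀ᵐ x : I, ∀ j, x ≠ τ ⟨P.a j, P.a_mem j⟩ :=
    ae_all_iff.2 fun j => Measure.ae_ne volume _
  filter_upwards [h1] with x hx
  exact (P.frobeniusPerron_eq hε f hx).symm

lemma aestronglyMeasurable_frobeniusPerron (P : ExpandingPartition ε τ) (hε : 0 < ε)
    {f : I → ℂ} (hf : AEStronglyMeasurable f volume) :
    AEStronglyMeasurable (frobeniusPerron τ f) volume := by
  refine AEStronglyMeasurable.congr ?_ (P.frobeniusPerron_ae_eq hε hf.ae_eq_mk.symm)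
  refine Measurable.aestronglyMeasurable (Finset.measurable_fun_sum _ fun i _ => ?_)
  have hinv := (P.branch hε i).continuous_inv.measurable
  refine Measurable.comp (Measurable.indicator (Measurable.mul ?_ ?_) measurableSet_Ioo)
    measurable_subtype_coe
  · exact hf.stronglyMeasurable_mk.measurable.comp (continuous_projIcc.measurable.comp hinv)
  · have h : Measurable fun x => ‖deriv (intervalMapExt τ) ((P.branch hε i).inv x)‖⁻¹ :=
      ((measurable_deriv _).comp hinv).norm.inv
    exact Complex.measurable_ofReal.comp h

end ExpandingPartition

/-! ### The `L^t` estimate for a single branch. -/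

namespace ExpandingBranch

variable {T : ℝ → ℝ} {ε s M : ℝ} (B : ExpandingBranch T ε s M)

lemma lintegralNorm_strips_le {t : ℝ} (ht : 1 ≤ t) (g : I → ℂ) (A r : ℝ) :
    lintegralNorm t (B.strips g A r)
      ≤ (supNear g (2 * A) B.a + supNear g (2 * A) B.b) * ENNReal.ofReal (2 * r) ^ (1 / t) := by
  refine (lintegralNorm_add_le ht (measurable_const.indicator Metric.isOpen_ball.measurableSet)
    (measurable_const.indicator Metric.isOpen_ball.measurableSet)).trans (le_of_eq ?_)
  rw [lintegralNorm_indicator_const ht, lintegralNorm_indicator_const ht, ← add_mul]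
  rcases B.inv_ends with ⟨h1, h2⟩ | ⟨h1, h2⟩ <;> rw [h1, h2]
  rw [add_comm]

lemma lintegralNorm_oscBound_le {t : ℝ} (ht : 1 ≤ t) (g : I → ℂ) {u : I → ℝ≥0∞}
    (hu : Measurable u) {A r : ℝ} (hrJ : 2 * r ≤ B.d - B.c) :
    lintegralNorm t (B.oscBound g u A r)
      ≤ ENNReal.ofReal ((1 + B.distortion r) * (1 + 2 ^ ε * B.distortion r))
          * (ENNReal.ofReal (s ^ (1 / t - 1)) * bvOscNorm (ENNReal.ofReal t) g (r / s))
        + ENNReal.ofReal (2 ^ ε * B.distortion r * (1 + B.distortion r))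
          * (ENNReal.ofReal (s ^ (1 / t - 1)) * lintegralNorm t (zeroExt u))
        + ENNReal.ofReal (1 + B.distortion r)
          * (ENNReal.ofReal (s ^ (1 / t - 1)) * bvOscNorm (ENNReal.ofReal t) g (r / s))
        + ENNReal.ofReal ((1 + B.distortion r) / s)
          * ((supNear g (2 * A) B.a + supNear g (2 * A) B.b)
            * ENNReal.ofReal (2 * r) ^ (1 / t)) := by
  have hpull (Φ : ℝ → ℝ≥0∞) :
      lintegralNorm t (B.pull Φ) ≤ ENNReal.ofReal (s ^ (1 / t - 1)) * lintegralNorm t Φ :=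
    (B.lintegralNorm_pull_le ht Φ).trans
      (mul_le_mul' le_rfl (lintegralNorm_indicator_le ht _ _))
  have m1 : Measurable (B.pull (zeroExt (bvOsc g (r / s)))) :=
    B.measurable_pull (measurable_zeroExt (measurable_bvOsc g _))
  have m2 : Measurable (B.pull (zeroExt u)) := B.measurable_pull (measurable_zeroExt hu)
  have m3 := B.measurable_reflect m1 r
  have m4 := B.measurable_strips g A r
  unfold oscBound
  rw [bvOscNorm_eq ht]
  refine (lintegralNorm_add_le ht (((m1.const_mul _).add (m2.const_mul _)).add
    (m3.const_mul _)) (m4.const_mul _)).trans (add_le_add ?_ ?_)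
  · refine (lintegralNorm_add_le ht ((m1.const_mul _).add (m2.const_mul _))
      (m3.const_mul _)).trans (add_le_add ?_ ?_)
    · refine (lintegralNorm_add_le ht (m1.const_mul _) (m2.const_mul _)).trans
        (add_le_add ?_ ?_)
      · rw [lintegralNorm_const_mul ht ENNReal.ofReal_ne_top]
        exact mul_le_mul' le_rfl (hpull _)
      · rw [lintegralNorm_const_mul ht ENNReal.ofReal_ne_top]
        exact mul_le_mul' le_rfl (hpull _)
    · rw [lintegralNorm_const_mul ht ENNReal.ofReal_ne_top]
      exact mul_le_mul' le_rfl ((B.lintegralNorm_reflect_le ht hrJ m1).trans (hpull _))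
  · rw [lintegralNorm_const_mul ht ENNReal.ofReal_ne_top]
    exact mul_le_mul' le_rfl (B.lintegralNorm_strips_le ht g A r)

end ExpandingBranch

/-! ### Summation over the partition. -/

/-- A sum over the ends of the intervals of a partition, where the interior points occur twice and
the two outer points once. -/
lemma sum_ends_le {n : ℕ} (hn : n ≠ 0) (h : Fin (n + 1) → ℝ≥0∞) {N : ℝ≥0∞}
    (hends : h 0 + h (Fin.last n) ≤ 2 * N) (hint : ∀ j, j ≠ 0 → j ≠ Fin.last n → h j ≤ N) :
    ∑ i : Fin n, (h i.castSucc + h i.succ) ≤ 2 * n * N := by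
  obtain ⟨m, rfl⟩ := Nat.exists_eq_succ_of_ne_zero hn
  rw [Finset.sum_add_distrib, Fin.sum_univ_succ, Fin.sum_univ_castSucc (fun i => h i.succ)]
  have h1 : ∑ i : Fin m, h i.succ.castSucc ≤ m * N := by
    refine (Finset.sum_le_card_nsmul _ _ N fun i _ => hint _ ?_ ?_).trans (by simp)
    · simp [Fin.ext_iff]
    · simp [Fin.ext_iff, i.2.ne]
  have h2 : ∑ i : Fin m, h i.castSucc.succ ≤ m * N := by
    simpa only [Fin.succ_castSucc] using h1
  calc h (Fin.castSucc 0) + ∑ i : Fin m, h i.succ.castSucc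
        + (∑ i : Fin m, h i.castSucc.succ + h (Fin.last m).succ)
      = (h 0 + h (Fin.last (m + 1)))
        + (∑ i : Fin m, h i.succ.castSucc + ∑ i : Fin m, h i.castSucc.succ) := by
        rw [Fin.castSucc_zero, Fin.succ_last]
        ring
    _ ≤ 2 * N + (m * N + m * N) := by gcongr
    _ = 2 * (m + 1 : ℕ) * N := by
      push_cast
      ring

namespace ExpandingPartition

variable {ε : ℝ} {τ : I → I} (P : ExpandingPartition ε τ)

lemma exists_gap : ∃ γ > 0, ∀ j k, j < k → γ ≤ P.a k - P.a j := by
  obtain ⟨γ, hγ, h⟩ : ∃ γ > 0, ∀ x ∈ {x : Fin (P.q + 1) × Fin (P.q + 1) | x.1 < x.2},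
      γ ≤ P.a x.2 - P.a x.1 := by
    rcases Set.eq_empty_or_nonempty {x : Fin (P.q + 1) × Fin (P.q + 1) | x.1 < x.2} with h | h
    · exact ⟨1, one_pos, by simp [h]⟩
    · obtain ⟨x, hx, hmin⟩ := (Set.toFinite _).exists_minimalFor
        (fun x : Fin (P.q + 1) × Fin (P.q + 1) => P.a x.2 - P.a x.1) _ h
      refine ⟨_, sub_pos.2 (P.strictMono_a hx), fun y hy => ?_⟩
      exact (le_total _ _).elim id fun h => hmin hy h
  exact ⟨γ, hγ, fun j k hjk => h (j, k) hjk⟩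

/-- The relative distortion of the branches on sets of diameter `r / s`. -/
noncomputable def distortion (r : ℝ) : ℝ := P.M * (r / P.s) ^ ε / P.s

lemma sum_supNear_le {t A : ℝ} (ht : 1 ≤ t) (hA : 0 < A)
    (hgap : ∀ j k, j < k → 6 * A ≤ P.a k - P.a j) (g : I → ℂ) :
    (∑ i : Fin P.q, (supNear g (2 * A) (P.a i.castSucc) + supNear g (2 * A) (P.a i.succ)))
        * ENNReal.ofReal (2 * A) ^ (1 / t)
      ≤ 2 * P.q * lintegralNorm t (zeroExt (absAddOsc g A)) := by
  have h6 : 6 * A ≤ 1 := by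
    have := hgap 0 (Fin.last _) (Fin.pos_iff_ne_zero.2 fun h => by
      have h' := P.a_last
      rw [h, P.a_zero] at h'
      exact zero_ne_one h')
    rwa [P.a_zero, P.a_last, sub_zero] at this
  rw [Finset.sum_mul]
  simp_rw [add_mul]
  refine sum_ends_le P.q_ne_zero
    (fun j => supNear g (2 * A) (P.a j) * ENNReal.ofReal (2 * A) ^ (1 / t)) ?_ fun j h0 h1 => ?_
  · rw [P.a_zero, P.a_last, ← add_mul]
    exact supNear_ends_mul_le ht hA h6 g
  · have k0 := hgap 0 j (Fin.pos_iff_ne_zero.2 h0)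
    have k1 := hgap j (Fin.last _) (Fin.lt_last_iff_ne_last.2 h1)
    rw [P.a_zero] at k0
    rw [P.a_last] at k1
    exact supNear_interior_mul_le ht hA g (by linarith) (by linarith)

lemma bvOscNorm_transfer_le {t A r : ℝ} (hε : 0 < ε) (ht : 1 ≤ t)
    (hgap : ∀ j k, j < k → 6 * A ≤ P.a k - P.a j) (hr : 0 < r) (hrA : r ≤ A) {g : I → ℂ}
    (hg : AEStronglyMeasurable g volume) :
    bvOscNorm (ENNReal.ofReal t) (P.transfer hε g) r
      ≤ ENNReal.ofReal (P.q * P.s ^ (1 / t - 1)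
          * ((1 + P.distortion r) * (1 + 2 ^ ε * P.distortion r) + (1 + P.distortion r)))
          * bvOscNorm (ENNReal.ofReal t) g (r / P.s)
        + ENNReal.ofReal (P.q * P.s ^ (1 / t - 1)
          * (2 ^ ε * P.distortion r * (1 + P.distortion r)))
          * eLpNorm g (ENNReal.ofReal t) volume
        + ENNReal.ofReal (2 * P.q * ((1 + P.distortion r) / P.s) * (r / A) ^ (1 / t))
          * lintegralNorm t (zeroExt (absAddOsc g A)) := by
  have hs : 0 < P.s := zero_lt_one.trans P.one_lt_s
  have hM := P.M_nonneg
  have hA : 0 < A := hr.trans_le hrA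
  have hδ : 0 ≤ P.distortion r := by
    unfold distortion
    positivity
  set δ := P.distortion r with hδdef
  -- The representative `g` is only almost everywhere measurable and must not be altered, since its
  -- oscillation depends on every value; only `|g|` in the distortion term is replaced.
  obtain ⟨u, hu, hug⟩ : ∃ u : I → ℝ≥0∞, Measurable u ∧ (fun x => ‖g x‖ₑ) =ᵐ[volume] u :=
    ⟨_, hg.enorm.measurable_mk, hg.enorm.ae_eq_mk⟩
  have hug' := ae_of_ae_unitInterval hug
  have hnorm : lintegralNorm t (zeroExt u) = eLpNorm g (ENNReal.ofReal t) volume := by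
    rw [eLpNorm_unitInterval ht]
    refine lintegralNorm_congr_ae ht ?_
    filter_upwards [hug'] with x hx
    by_cases h : x ∈ Icc (0 : ℝ) 1
    · simp only [zeroExt, indicator_of_mem h]
      exact (hx h).symm
    · simp only [zeroExt, indicator_of_notMem h]
  -- Expansion gives images of length at least `6A s`, more than the required `2r`.
  have hJ (i : Fin P.q) : 2 * r ≤ (P.branch hε i).d - (P.branch hε i).c := by
    have h1 := (P.branch hε i).expansion
    rw [P.branch_a, P.branch_b] at h1
    have h2 := hgap _ _ i.castSucc_lt_succ
    nlinarith [P.one_lt_s]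
  have hpt (i : Fin P.q) : lintegralNorm t (zeroExt (bvOsc ((P.branch hε i).transfer g) r))
      ≤ lintegralNorm t ((P.branch hε i).oscBound g u A r) := by
    set B := P.branch hε i
    refine lintegralNorm_mono_ae ht ?_
    filter_upwards [B.ae_inv hug', Measure.ae_ne volume B.c, Measure.ae_ne volume B.d]
      with x hx hc hd
    by_cases h : x ∈ Icc (0 : ℝ) 1
    · rw [zeroExt_of_mem _ h]
      refine B.bvOsc_transfer_le g u hrA (hJ i) hc hd fun hxJ => ?_
      have h2 := B.mem_unitInterval (B.mapsTo_inv hxJ)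
      have h1 := hx hxJ h2
      rw [projIcc_of_mem _ h2] at h1
      rw [zeroExt_of_mem _ h2]
      exact h1.le
    · simp [zeroExt, h]
  have hsum : bvOscNorm (ENNReal.ofReal t) (P.transfer hε g) r
      ≤ ∑ i, lintegralNorm t ((P.branch hε i).oscBound g u A r) := by
    rw [bvOscNorm_eq ht]
    refine le_trans ?_ (Finset.sum_le_sum fun i _ => hpt i)
    refine (lintegralNorm_mono ht fun x => ?_).trans (lintegralNorm_sum_le ht Finset.univ
      fun i => measurable_zeroExt (measurable_bvOsc ((P.branch hε i).transfer g) r))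
    by_cases h : x ∈ Icc (0 : ℝ) 1
    · simp only [zeroExt_of_mem _ h]
      exact bvOsc_sum_le _ _ r _
    · simp [zeroExt, h]
  refine hsum.trans ((Finset.sum_le_sum fun i _ =>
    (P.branch hε i).lintegralNorm_oscBound_le ht g hu (A := A) (hJ i)).trans ?_)
  have hδi (i : Fin P.q) : (P.branch hε i).distortion r = δ := rfl
  simp only [hδi, P.branch_a, P.branch_b, Finset.sum_add_distrib, Finset.sum_const,
    Finset.card_univ, Fintype.card_fin, nsmul_eq_mul, hnorm]
  rw [← Finset.mul_sum, ← Finset.sum_mul]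
  have hq : (P.q : ℝ≥0∞) = ENNReal.ofReal P.q := (ENNReal.ofReal_natCast _).symm
  have hs' : 0 ≤ P.s ^ (1 / t - 1) := by positivity
  refine add_le_add (le_of_eq ?_) ?_
  · have e (k : ℝ) : ENNReal.ofReal (P.q * P.s ^ (1 / t - 1) * k)
        = P.q * ENNReal.ofReal (P.s ^ (1 / t - 1)) * ENNReal.ofReal k := by
      rw [hq, ENNReal.ofReal_mul (by positivity), ENNReal.ofReal_mul (by positivity)]
    rw [e, e, ENNReal.ofReal_add (p := (1 + δ) * (1 + 2 ^ ε * δ)) (q := 1 + δ) (by positivity)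
      (by positivity)]
    ring
  -- The strips have width `2r` but the suprema are controlled at scale `2A`; the ratio is the
  -- factor `(r/A)^(1/t)`.
  · have e : ENNReal.ofReal (2 * r) ^ (1 / t)
        = ENNReal.ofReal ((r / A) ^ (1 / t)) * ENNReal.ofReal (2 * A) ^ (1 / t) := by
      rw [ENNReal.ofReal_rpow_of_pos (by positivity), ENNReal.ofReal_rpow_of_pos (by positivity),
        ← ENNReal.ofReal_mul (by positivity), ← Real.mul_rpow (by positivity) (by positivity)]
      congr 2
      field_simp
    have h := P.sum_supNear_le ht hA hgap g
    rw [e]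
    calc _ = ENNReal.ofReal ((1 + δ) / P.s) * ENNReal.ofReal ((r / A) ^ (1 / t))
          * ((∑ i : Fin P.q, (supNear g (2 * A) (P.a i.castSucc)
            + supNear g (2 * A) (P.a i.succ))) * ENNReal.ofReal (2 * A) ^ (1 / t)) := by ring
      _ ≤ ENNReal.ofReal ((1 + δ) / P.s) * ENNReal.ofReal ((r / A) ^ (1 / t))
          * (2 * P.q * lintegralNorm t (zeroExt (absAddOsc g A))) := by gcongr
      _ = _ := by
        rw [hq, ENNReal.ofReal_mul (by positivity), ENNReal.ofReal_mul (by positivity),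
          ENNReal.ofReal_mul (by positivity), ENNReal.ofReal_ofNat]
        ring

lemma eLpNorm_transfer_le {t : ℝ} (hε : 0 < ε) (ht : 1 ≤ t) {g : I → ℂ}
    (hg : AEStronglyMeasurable g volume) :
    eLpNorm (P.transfer hε g) (ENNReal.ofReal t) volume
      ≤ P.q * eLpNorm g (ENNReal.ofReal t) volume := by
  obtain ⟨u, hu, hug⟩ : ∃ u : I → ℂ, Measurable u ∧ g =ᵐ[volume] u :=
    ⟨_, hg.stronglyMeasurable_mk.measurable, hg.ae_eq_mk⟩
  rw [eLpNorm_congr_ae hug, eLpNorm_congr_ae (P.transfer_congr_ae hε hug),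
    eLpNorm_unitInterval ht, eLpNorm_unitInterval ht]
  have hm := measurable_zeroExt hu.enorm
  have h1 : lintegralNorm t (zeroExt fun x => ‖P.transfer hε u x‖ₑ)
      ≤ ∑ i, lintegralNorm t ((P.branch hε i).pull (zeroExt fun z => ‖u z‖ₑ)) := by
    refine (lintegralNorm_mono ht fun x => ?_).trans (lintegralNorm_sum_le ht Finset.univ
      fun i => (P.branch hε i).measurable_pull hm)
    by_cases h : x ∈ Icc (0 : ℝ) 1
    · rw [zeroExt_of_mem _ h]
      refine (enorm_sum_le _ _).trans (le_of_eq (Finset.sum_congr rfl fun i _ => ?_))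
      exact (P.branch hε i).enorm_transfer_eq u ⟨x, h⟩
    · simp [zeroExt, h]
  refine h1.trans ((Finset.sum_le_card_nsmul _ _ (lintegralNorm t (zeroExt fun z => ‖u z‖ₑ))
    fun i _ => ?_).trans (by simp))
  refine ((P.branch hε i).lintegralNorm_pull_le ht _).trans ?_
  refine (mul_le_mul' ?_ (lintegralNorm_indicator_le ht _ _)).trans (one_mul _).le
  rw [ENNReal.ofReal_le_one]
  refine Real.rpow_le_one_of_one_le_of_nonpos P.one_lt_s.le ?_
  rw [sub_nonpos, div_le_one (by linarith)]
  exact ht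

lemma enorm_transfer_le (hε : 0 < ε) {g : I → ℂ} {K : ℝ≥0∞} (hK : ∀ z, ‖g z‖ₑ ≤ K) (x : I) :
    ‖P.transfer hε g x‖ₑ ≤ P.q * K := by
  refine (enorm_sum_le _ _).trans ((Finset.sum_le_card_nsmul _ _ K fun i _ => ?_).trans (by simp))
  set B := P.branch hε i
  by_cases hx : (x : ℝ) ∈ Ioo B.c B.d
  · rw [B.transfer_of_mem g hx, enorm_mul]
    refine (mul_le_mul' (hK _) ?_).trans (mul_one K).le
    rw [← ofReal_norm, Complex.norm_real, Real.norm_of_nonneg (by positivity),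
      ENNReal.ofReal_le_one]
    refine (B.weight_le (B.mapsTo_inv hx)).trans ?_
    rw [div_le_one B.s_pos]
    exact B.one_lt_s.le
  · rw [B.transfer_of_notMem g hx, enorm_zero]
    exact zero_le

/-- Each image has length at least `s` times its interval and at most `1`; the intervals have total
length `1`. -/
lemma s_le_q (hε : 0 < ε) : P.s ≤ P.q := by
  have hs : 0 < P.s := zero_lt_one.trans P.one_lt_s
  have h (i : Fin P.q) : P.s * (P.a i.succ - P.a i.castSucc) ≤ 1 := by
    set B := P.branch hε i with hB
    have h1 := B.expansion
    rw [P.branch_a, P.branch_b] at h1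
    refine h1.trans ?_
    have hsub : Ioo B.c B.d ⊆ Icc 0 1 := by
      rw [← B.image_eq]
      rintro _ ⟨z, hz, rfl⟩
      have hz' := B.mem_unitInterval hz
      have e : intervalMapExt τ z = τ ⟨z, hz'⟩ := IccExtend_val _ _ (⟨z, hz'⟩ : I)
      rw [e]
      exact (τ ⟨z, hz'⟩).2
    have h2 := closure_mono hsub
    rw [closure_Ioo B.c_lt_d.ne, isClosed_Icc.closure_eq] at h2
    linarith [(h2 ⟨le_rfl, B.c_lt_d.le⟩).1, (h2 ⟨B.c_lt_d.le, le_rfl⟩).2]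
  have hsum : ∑ i : Fin P.q, (P.a i.succ - P.a i.castSucc) = 1 := by
    rw [Finset.sum_sub_distrib, ← sub_eq_zero]
    have e1 := Fin.sum_univ_succ P.a
    have e2 := Fin.sum_univ_castSucc P.a
    rw [P.a_zero] at e1
    rw [P.a_last] at e2
    linarith
  calc P.s = ∑ i : Fin P.q, P.s * (P.a i.succ - P.a i.castSucc) := by
        rw [← Finset.mul_sum, hsum, mul_one]
    _ ≤ ∑ _i : Fin P.q, (1 : ℝ) := Finset.sum_le_sum fun i _ => h i
    _ = P.q := by simp

end ExpandingPartition

/-! ### The explicit constants and passage to classes. -/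

namespace ExpandingPartition

variable {τ : I → I} {t p : ℝ} (P : ExpandingPartition (1 / p) τ)

lemma one_le_alpha (hp : 0 < p) {A : ℝ} (hA : 0 < A) : 1 ≤ P.alpha A t p := by
  have hs : 0 < P.s := zero_lt_one.trans P.one_lt_s
  have hM := P.M_nonneg
  have hD : 0 ≤ P.D A p := by
    unfold D
    positivity
  have h : 1 ≤ 2 * P.q * (1 + P.D A p) / P.s := by
    rw [le_div_iff₀ hs, one_mul]
    have h1 := P.s_le_q (by positivity)
    have h2 : 0 ≤ (P.q : ℝ) * P.D A p := by positivity
    linarith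
  exact h.trans (le_add_of_nonneg_left (by positivity))

lemma beta_pos {A : ℝ} (hA : 0 < A) : 0 < P.beta A t p := by
  have hs : 0 < P.s := zero_lt_one.trans P.one_lt_s
  have hM := P.M_nonneg
  have hD : 0 ≤ P.D A p := by
    unfold D
    positivity
  have hq : 0 < (P.q : ℝ) := Nat.cast_pos.2 (Nat.pos_of_ne_zero P.q_ne_zero)
  unfold beta
  positivity

/-- `D` is the distortion at `r = A`, hence dominates it for `r ≤ A`. The contracted radius supplies
the factor `s^(-1/p)`. -/
lemma coeff_le {A r : ℝ} (ht : 0 < t) (htp : t ≤ p) (hr : 0 < r) (hrA : r ≤ A) :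
    (P.q * P.s ^ (1 / t - 1) * ((1 + P.distortion r) * (1 + 2 ^ (1 / p) * P.distortion r)
        + (1 + P.distortion r))) * (r / P.s) ^ (1 / p)
      + (2 * P.q * ((1 + P.distortion r) / P.s) * (r / A) ^ (1 / t)) * A ^ (1 / p)
        ≤ r ^ (1 / p) * P.alpha A t p ∧
    (P.q * P.s ^ (1 / t - 1) * (2 ^ (1 / p) * P.distortion r * (1 + P.distortion r)))
      + 2 * P.q * ((1 + P.distortion r) / P.s) * (r / A) ^ (1 / t)
        ≤ r ^ (1 / p) * P.beta A t p := by
  have hp : 0 < p := ht.trans_le htp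
  have hs : 0 < P.s := zero_lt_one.trans P.one_lt_s
  have hM := P.M_nonneg
  have hA : 0 < A := hr.trans_le hrA
  have e1 : P.s ^ (1 + 1 / p) = P.s * P.s ^ (1 / p) := by rw [Real.rpow_add hs, Real.rpow_one]
  have e2 : P.s ^ (1 + 1 / p - 1 / t) = P.s ^ (1 / p) / P.s ^ (1 / t - 1) := by
    rw [← Real.rpow_sub hs]
    congr 1
    ring
  have e3 : P.s ^ (2 + 1 / p - 1 / t) = P.s * P.s ^ (1 / p) / P.s ^ (1 / t - 1) := by
    rw [← e1, ← Real.rpow_sub hs]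
    congr 1
    ring
  have e4 : (r / P.s) ^ (1 / p) = r ^ (1 / p) / P.s ^ (1 / p) := Real.div_rpow hr.le hs.le _
  have hx : (r / A) ^ (1 / t) ≤ r ^ (1 / p) / A ^ (1 / p) := by
    rw [← Real.div_rpow hr.le hA.le]
    refine Real.rpow_le_rpow_of_exponent_ge (by positivity) ((div_le_one hA).2 hrA) ?_
    exact one_div_le_one_div_of_le ht htp
  have hRa : r ^ (1 / p) ≤ A ^ (1 / p) := by gcongr
  unfold alpha beta
  rw [e2, e3, distortion, D, e1, e4]
  have hR : 0 < r ^ (1 / p) := by positivity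
  have ha : 0 < A ^ (1 / p) := by positivity
  have hS : 0 < P.s ^ (1 / p) := by positivity
  have he : 0 < P.s ^ (1 / t - 1) := by positivity
  have hc : (0 : ℝ) < 2 ^ (1 / p) := by positivity
  have hq : (0 : ℝ) ≤ P.q := by positivity
  have hX : 0 ≤ (r / A) ^ (1 / t) := by positivity
  generalize r ^ (1 / p) = R at *
  generalize A ^ (1 / p) = a at *
  generalize P.s ^ (1 / p) = S at *
  generalize P.s ^ (1 / t - 1) = e at *
  generalize (2 : ℝ) ^ (1 / p) = c at *
  generalize (P.q : ℝ) = q at *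
  generalize (r / A) ^ (1 / t) = x at *
  generalize P.s = s at *
  generalize P.M = M at *
  have hδD : M * (R / S) / s ≤ M * a / (s * S) := by
    rw [show M * (R / S) / s = M * R / (s * S) by field_simp]
    gcongr
  have hδ0 : 0 ≤ M * (R / S) / s := by positivity
  have hδM : M * (R / S) / s = M * R / (s * S) := by field_simp
  generalize M * a / (s * S) = D at *
  constructor
  · generalize M * (R / S) / s = δ at *
    have hD : 0 ≤ D := hδ0.trans hδD
    calc q * e * ((1 + δ) * (1 + c * δ) + (1 + δ)) * (R / S) + 2 * q * ((1 + δ) / s) * x * a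
        ≤ q * e * ((1 + D) * (1 + c * D) + (1 + D)) * (R / S)
          + 2 * q * ((1 + D) / s) * (R / a) * a := by gcongr
      _ = _ := by
        field_simp
        ring
  · have hD : 0 ≤ D := hδ0.trans hδD
    -- One distortion factor is kept exact, as it provides the power `R = r^(1/p)`; only the other
    -- is enlarged to `D`.
    have h1 : c * (M * (R / S) / s) * (1 + M * (R / S) / s)
        ≤ c * (M * R / (s * S)) * (1 + D) := by
      rw [← hδM]
      gcongr
    calc q * e * (c * (M * (R / S) / s) * (1 + M * (R / S) / s))
          + 2 * q * ((1 + M * (R / S) / s) / s) * x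
        ≤ q * e * (c * (M * R / (s * S)) * (1 + D)) + 2 * q * ((1 + D) / s) * (R / a) := by
          gcongr
      _ = _ := by
        field_simp

lemma bvVarFun_transfer_le {A : ℝ} (hε : 0 < 1 / p) (ht : 1 ≤ t) (htp : t ≤ p)
    (hgap : ∀ j k, j < k → 6 * A ≤ P.a k - P.a j) {g : I → ℂ}
    (hg : AEStronglyMeasurable g volume) :
    bvVarFun A (ENNReal.ofReal t) p (P.transfer hε g)
      ≤ ENNReal.ofReal (P.alpha A t p) * bvVarFun A (ENNReal.ofReal t) p g
        + ENNReal.ofReal (P.beta A t p) * eLpNorm g (ENNReal.ofReal t) volume := by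
  refine bvVarFun_le fun r hr hrA => ?_
  have hA := hr.trans_le hrA
  have hs : 0 < P.s := zero_lt_one.trans P.one_lt_s
  have hM := P.M_nonneg
  have hδ : 0 ≤ P.distortion r := by
    unfold distortion
    positivity
  obtain ⟨h1, h2⟩ := P.coeff_le (by linarith) htp hr hrA
  refine (P.bvOscNorm_transfer_le hε ht hgap hr hrA hg).trans ?_
  have k1 := bvOscNorm_le (t := t) (A := A) (p := p) g (div_pos hr hs)
    ((div_le_self hr.le P.one_lt_s.le).trans hrA)
  have k2 := lintegralNorm_absAddOsc_le (p := p) ht hA hg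
  refine (add_le_add (add_le_add_left (mul_le_mul' le_rfl k1) _)
    (mul_le_mul' le_rfl k2)).trans ?_
  have hr' : 0 ≤ r ^ (1 / p) := by positivity
  rw [mul_add (ENNReal.ofReal (r ^ (1 / p))), ← mul_assoc (ENNReal.ofReal (r ^ (1 / p))),
    ← mul_assoc (ENNReal.ofReal (r ^ (1 / p))), ← ENNReal.ofReal_mul hr',
    ← ENNReal.ofReal_mul hr']
  refine le_trans (le_of_eq ?_) (add_le_add
    (mul_le_mul' (ENNReal.ofReal_le_ofReal h1) le_rfl)
    (mul_le_mul' (ENNReal.ofReal_le_ofReal h2) le_rfl))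
  rw [ENNReal.ofReal_add (by positivity) (by positivity),
    ENNReal.ofReal_add (by positivity) (by positivity),
    ENNReal.ofReal_mul (q := (r / P.s) ^ (1 / p)) (by positivity),
    ENNReal.ofReal_mul (q := A ^ (1 / p)) (by positivity)]
  ring

/-- The variation at scales up to `B` of the image of a function is bounded by means of its
variation at scales up to `A`, where `A ≤ B` is small. -/
lemma bvVarFun_transfer_le_of_le {A B : ℝ} (hε : 0 < 1 / p) (ht : 1 ≤ t) (htp : t ≤ p)
    (hA : 0 < A) (hAB : A ≤ B) (hgap : ∀ j k, j < k → 6 * A ≤ P.a k - P.a j) (hA6 : 6 * A ≤ 1) :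
    ∃ a ≥ (0 : ℝ), ∃ b ≥ (0 : ℝ), ∀ g : I → ℂ, AEStronglyMeasurable g volume →
      bvVarFun B (ENNReal.ofReal t) p (P.transfer hε g)
        ≤ ENNReal.ofReal a * bvVarFun B (ENNReal.ofReal t) p g
          + ENNReal.ofReal b * eLpNorm g (ENNReal.ofReal t) volume := by
  have h0 : 0 < t := by linarith
  have hα : 0 ≤ P.alpha A t p := zero_le_one.trans (P.one_le_alpha (h0.trans_le htp) hA)
  have hβ := P.beta_pos (t := t) hA
  -- Chosen so that `A^(1/p) k N` is the uniform oscillation bound `2 q A^(-1/t) N`; for `r ≥ A` it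
  -- is then at most `r^(1/p) k N`.
  set k : ℝ := (A ^ (1 / p))⁻¹ * (2 * (P.q * (A ^ (1 / t))⁻¹)) with hk
  have hk0 : 0 ≤ k := by positivity
  refine ⟨P.alpha A t p + k * A ^ (1 / p), by positivity, P.beta A t p + k, by positivity,
    fun g hg => ?_⟩
  set V := bvVarFun B (ENNReal.ofReal t) p g
  set G := eLpNorm g (ENNReal.ofReal t) volume
  have hV : bvVarFun A (ENNReal.ofReal t) p g ≤ V := bvVarFun_mono hAB _ _ _
  set N := lintegralNorm t (zeroExt (absAddOsc g A))
  have hN : N ≤ G + ENNReal.ofReal (A ^ (1 / p)) * V :=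
    (lintegralNorm_absAddOsc_le (p := p) ht hA hg).trans (by gcongr)
  have hsup (z : I) : ‖g z‖ₑ ≤ ENNReal.ofReal (A ^ (1 / t))⁻¹ * N := by
    have h := enorm_mul_le ht hA hA6 g z
    have hpos : 0 < A ^ (1 / t) := by positivity
    rwa [ENNReal.ofReal_rpow_of_pos hA,
      ← ENNReal.le_div_iff_mul_le (.inl (ENNReal.ofReal_pos.2 hpos).ne') (.inl ENNReal.ofReal_ne_top),
      div_eq_mul_inv, ← ENNReal.ofReal_inv_of_pos hpos, mul_comm] at h
  have hosc (r : ℝ) : bvOscNorm (ENNReal.ofReal t) (P.transfer hε g) r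
      ≤ 2 * (P.q * (ENNReal.ofReal (A ^ (1 / t))⁻¹ * N)) := by
    rw [bvOscNorm, eLpNorm_eq_lintegral_rpow_enorm_toReal (by simpa using h0)
        ENNReal.ofReal_ne_top, ENNReal.toReal_ofReal h0.le]
    calc _ ≤ (∫⁻ _ : I, (2 * (P.q * (ENNReal.ofReal (A ^ (1 / t))⁻¹ * N))) ^ t) ^ (1 / t) := by
          gcongr with x
          exact bvOsc_le_two_mul _ (P.enorm_transfer_le hε hsup) r x
      _ = _ := by
        rw [lintegral_const, measure_univ, mul_one, ← ENNReal.rpow_mul,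
          mul_one_div_cancel h0.ne', ENNReal.rpow_one]
  have hsmall := P.bvVarFun_transfer_le hε ht htp hgap hg
  rw [ENNReal.ofReal_add hα (by positivity), ENNReal.ofReal_add hβ.le hk0,
    ENNReal.ofReal_mul hk0]
  refine bvVarFun_le fun r hr hrB => ?_
  rcases le_total r A with hrA | hrA
  · refine (bvOscNorm_le (p := p) (P.transfer hε g) hr hrA).trans ?_
    gcongr
    refine hsmall.trans ?_
    gcongr <;> exact le_self_add
  · have hkey : ENNReal.ofReal k * N ≤ (ENNReal.ofReal (P.alpha A t p)
        + ENNReal.ofReal k * ENNReal.ofReal (A ^ (1 / p))) * V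
        + (ENNReal.ofReal (P.beta A t p) + ENNReal.ofReal k) * G := by
      calc ENNReal.ofReal k * N ≤ ENNReal.ofReal k * (G + ENNReal.ofReal (A ^ (1 / p)) * V) := by
            gcongr
        _ = ENNReal.ofReal k * ENNReal.ofReal (A ^ (1 / p)) * V + ENNReal.ofReal k * G := by ring
        _ ≤ _ := by gcongr <;> exact le_add_self
    refine le_trans ?_ (mul_le_mul' le_rfl hkey)
    have hAr : A ^ (1 / p) ≤ r ^ (1 / p) := by gcongr
    have hpos : 0 < A ^ (1 / p) := by positivity
    calc _ ≤ 2 * (P.q * (ENNReal.ofReal (A ^ (1 / t))⁻¹ * N)) := hosc r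
      _ = ENNReal.ofReal (A ^ (1 / p)) * (ENNReal.ofReal k * N) := by
        rw [← mul_assoc, ← mul_assoc, ← mul_assoc, ← ENNReal.ofReal_mul hpos.le, hk,
          mul_inv_cancel_left₀ hpos.ne', ENNReal.ofReal_mul zero_le_two,
          ENNReal.ofReal_mul (by positivity), ENNReal.ofReal_natCast, ENNReal.ofReal_ofNat,
          ← mul_assoc]
      _ ≤ _ := by gcongr

/-- A bound for the variation of the representatives gives a bound for the variation of the
class. -/
lemma bvVar_frobeniusPerron_le {A a b : ℝ} (hε : 0 < 1 / p)
    (h : ∀ g : I → ℂ, AEStronglyMeasurable g volume →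
      bvVarFun A (ENNReal.ofReal t) p (P.transfer hε g)
        ≤ ENNReal.ofReal a * bvVarFun A (ENNReal.ofReal t) p g
          + ENNReal.ofReal b * eLpNorm g (ENNReal.ofReal t) volume)
    {f : I → ℂ} (hf : AEStronglyMeasurable f volume) :
    bvVar A (ENNReal.ofReal t) p (frobeniusPerron τ f)
      ≤ ENNReal.ofReal a * bvVar A (ENNReal.ofReal t) p f
        + ENNReal.ofReal b * eLpNorm f (ENNReal.ofReal t) volume := by
  -- A factor is moved through the infimum only when it is nonzero. For `a ≤ 0` the variation term
  -- vanishes and `f` itself serves as representative.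
  rcases le_or_gt a 0 with ha | ha
  · refine (iInf₂_le (P.transfer hε f) (P.frobeniusPerron_ae_eq hε (ae_eq_refl f))).trans
      ((h f hf).trans ?_)
    simp [ENNReal.ofReal_of_nonpos ha]
  have ha' : ENNReal.ofReal a ≠ 0 := by simpa using ha
  unfold bvVar
  simp_rw [iInf_subtype', ENNReal.mul_iInf_of_ne ha' ENNReal.ofReal_ne_top, ENNReal.iInf_add]
  refine le_iInf fun g => ?_
  refine (iInf_le _ ⟨P.transfer hε g, P.frobeniusPerron_ae_eq hε g.2⟩).trans ?_
  rw [← eLpNorm_congr_ae g.2]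
  exact h g (hf.congr g.2.symm)

/-- The `L^t` part of the norm grows by at most the factor `q`, which is added to the constant of
the weak norm. -/
lemma bvNorm_frobeniusPerron_le {A a b : ℝ} (hε : 0 < 1 / p) (ht : 1 ≤ t) (hb : 0 ≤ b)
    {f : I → ℂ} (hf : AEStronglyMeasurable f volume)
    (h : bvVar A (ENNReal.ofReal t) p (frobeniusPerron τ f)
      ≤ ENNReal.ofReal a * bvNorm A (ENNReal.ofReal t) p f
        + ENNReal.ofReal b * eLpNorm f (ENNReal.ofReal t) volume) :
    bvNorm A (ENNReal.ofReal t) p (frobeniusPerron τ f)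
      ≤ ENNReal.ofReal a * bvNorm A (ENNReal.ofReal t) p f
        + ENNReal.ofReal (b + P.q) * eLpNorm f (ENNReal.ofReal t) volume := by
  have h1 : eLpNorm (frobeniusPerron τ f) (ENNReal.ofReal t) volume
      ≤ P.q * eLpNorm f (ENNReal.ofReal t) volume := by
    rw [← eLpNorm_congr_ae (P.frobeniusPerron_ae_eq hε (ae_eq_refl f))]
    exact P.eLpNorm_transfer_le hε ht hf
  rw [bvNorm, ENNReal.ofReal_add hb (by positivity), ENNReal.ofReal_natCast, add_mul, ← add_assoc]
  exact add_le_add h h1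

end ExpandingPartition

theorem theorem3p3p3 (t p : ℝ) (ht : 1 < t) (htp : t ≤ p) (τ : I → I)
    (P : ExpandingPartition (1 / p) τ) :
    -- for every value `A > 0` of the parameter in the definition of the variation
    (∀ A : ℝ, 0 < A →
      (∃ α > (0 : ℝ), ∃ K > (0 : ℝ), ∀ f : I → ℂ, MemBV A (ENNReal.ofReal t) p f →
        bvNorm A (ENNReal.ofReal t) p (frobeniusPerron τ f) ≤
          ENNReal.ofReal α * bvNorm A (ENNReal.ofReal t) p f
            + ENNReal.ofReal K * eLpNorm f (ENNReal.ofReal t) volume) ∧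
      (∀ f : I → ℂ, MemBV A (ENNReal.ofReal t) p f →
        MemBV A (ENNReal.ofReal t) p (frobeniusPerron τ f))) ∧
    -- for all small `A`, with the explicit constants, where `α` is not less than `1`
    (∃ A₀ > (0 : ℝ), ∀ A ∈ Ioc (0 : ℝ) A₀,
      1 ≤ P.alpha A t p ∧ 0 < P.beta A t p ∧
      (∀ f : I → ℂ, MemBV A (ENNReal.ofReal t) p f →
        bvVar A (ENNReal.ofReal t) p (frobeniusPerron τ f) ≤
          ENNReal.ofReal (P.alpha A t p) * bvNorm A (ENNReal.ofReal t) p f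
            + ENNReal.ofReal (P.beta A t p) * eLpNorm f (ENNReal.ofReal t) volume) ∧
      (∃ K > (0 : ℝ), ∀ f : I → ℂ, MemBV A (ENNReal.ofReal t) p f →
        bvNorm A (ENNReal.ofReal t) p (frobeniusPerron τ f) ≤
          ENNReal.ofReal (P.alpha A t p) * bvNorm A (ENNReal.ofReal t) p f
            + ENNReal.ofReal K * eLpNorm f (ENNReal.ofReal t) volume)) := by
  have hp : 0 < p := by linarith
  have hε : 0 < 1 / p := by positivity
  have hq : 0 < (P.q : ℝ) := Nat.cast_pos.2 (Nat.pos_of_ne_zero P.q_ne_zero)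
  obtain ⟨γ, hγ, hgap⟩ := P.exists_gap
  have hγ1 : γ ≤ 1 := by
    have h := hgap _ _ (0 : Fin P.q).castSucc_lt_succ
    linarith [(P.a_mem (0 : Fin P.q).succ).2, (P.a_mem (0 : Fin P.q).castSucc).1]
  have hvar {A a b : ℝ} {f : I → ℂ}
      (h : bvVar A (ENNReal.ofReal t) p (frobeniusPerron τ f)
        ≤ ENNReal.ofReal a * bvVar A (ENNReal.ofReal t) p f
          + ENNReal.ofReal b * eLpNorm f (ENNReal.ofReal t) volume) :
      bvVar A (ENNReal.ofReal t) p (frobeniusPerron τ f)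
        ≤ ENNReal.ofReal a * bvNorm A (ENNReal.ofReal t) p f
          + ENNReal.ofReal b * eLpNorm f (ENNReal.ofReal t) volume :=
    h.trans (add_le_add_left (mul_le_mul' le_rfl le_self_add) _)
  -- `γ` is a lower bound for the partition gaps, so `A ≤ γ / 6` provides the gap `6A` needed for
  -- separated neighbourhoods of the ends.
  refine ⟨fun A hA => ?_, γ / 6, by positivity, fun A hA => ?_⟩
  · have hA₁ : 0 < min A (γ / 6) := lt_min hA (by positivity)
    have h6 : 6 * min A (γ / 6) ≤ γ := by linarith [min_le_right A (γ / 6)]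
    obtain ⟨a, ha, b, hb, h⟩ := P.bvVarFun_transfer_le_of_le hε ht.le htp hA₁ (min_le_left _ _)
      (fun j k hjk => h6.trans (hgap j k hjk)) (h6.trans hγ1)
    have hbv (f : I → ℂ) (hf : MemBV A (ENNReal.ofReal t) p f) :=
      P.bvVar_frobeniusPerron_le hε h hf.1
    refine ⟨⟨a + 1, by positivity, b + P.q, by positivity, fun f hf => ?_⟩, fun f hf => ?_⟩
    · refine P.bvNorm_frobeniusPerron_le hε ht.le hb hf.1 ((hvar (hbv f hf)).trans ?_)
      gcongr
      linarith
    · refine ⟨P.aestronglyMeasurable_frobeniusPerron hε hf.1, (hbv f hf).trans_lt ?_⟩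
      exact ENNReal.add_lt_top.2 ⟨ENNReal.mul_lt_top ENNReal.ofReal_lt_top hf.2,
        ENNReal.mul_lt_top ENNReal.ofReal_lt_top (eLpNorm_lt_top_of_bvVar hA ht.le hf.2)⟩
  · have h6 : 6 * A ≤ γ := by linarith [hA.2]
    have hβ := P.beta_pos (t := t) hA.1
    have hbv (f : I → ℂ) (hf : MemBV A (ENNReal.ofReal t) p f) :=
      hvar (P.bvVar_frobeniusPerron_le hε (fun g hg => P.bvVarFun_transfer_le hε ht.le htp
        (fun j k hjk => h6.trans (hgap j k hjk)) hg) hf.1)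
    exact ⟨P.one_le_alpha hp hA.1, hβ, hbv, P.beta A t p + P.q, by positivity, fun f hf =>
      P.bvNorm_frobeniusPerron_le hε ht.le hβ.le hf.1 (hbv f hf)⟩
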